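/- **Setting.** A (non-interactive) randomised 1-out-of-2 string OT protocol with $n$-bit messages in the isolated qubits model: Alice draws private coins $\omega$ from a finite set, sends Bob a state $\rho_\omega$ of $m$ qubits and outputs two $n$-bit strings depending on $\omega$; honest Bob, with choice bit $d\in\{0,1\}$, performs an LOCC measurement (a finite sequence of adaptive single-qubit generalized measurements) and decodes its transcript to an $n$-bit string. The protocol is correct with error $\eta$ if for each $d$ Bob's string equals Alice's string number $d$ with probability at least $1-\eta$. A separable measurement is one with finitely many outcomes, each of whose Kraus operators is a tensor product of $m$ single-qubit operators; every LOCC measurement is separable. A separable outcome is an operator $0\preceq M\preceq I$ of the form $M=K^\dagger K$ with $K=K_1\otimes\cdots\otimes K_m$; it is $\delta$-non-negligible for the state $\rho$ of the $m$ qubits averaged over $\omega$ if $\mathrm{Tr}(M\rho)\ge\delta\,\mathrm{Tr}(M)/2^m$. The smooth min-entropy is $H^\varepsilon_\infty(X)=\max_{\mathcal E:\Pr(\mathcal E)\ge 1-\varepsilon}\min_x\left[-\log_2\Pr(\mathcal E,X=x)\right]$. Distances are $\ell_1$-distances, $\|P-Q\|_1=\sum_x|P(x)-Q(x)|$. A family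 of functions $\{0,1\}^\ell\to\{0,1\}^{\ell'}$ is $r$-wise independent if, for a uniformly random member $H$ and every set $S$ of at most $r$ points, the values $H(x)$, $x\in S$, are independent and uniform. **Theorem 3.1.** For all constants $\theta\ge1$, $\delta_0>0$, $\alpha>0$ there is a constant $\gamma>0$ such that for all constants $\varepsilon_0>0$ and $0<\kappa<\min\{\delta_0/2,\ \varepsilon_0/2,\ \alpha/4\}$ there are constants $k_0\ge1$ and $c_1,c_2>0$ for which the following holds for every integer $k\ge k_0$. Suppose we are given a protocol as above in which Alice outputs $S,T\in\{0,1\}^\ell$, $\ell\ge k$, which uses $m$ qubits with $k\le m\le k^\theta$, which is correct with error $\eta$, and which has the following "leaky" security, for some $0\le\varepsilon\le2^{-\varepsilon_0k}$: for every nonzero separable measurement outcome $M$ that is $2^{-\delta_0k}$-non-negligible, $$H_\infty^{\varepsilon}(S,T\mid Z=M)\ge\alpha k ,$$ where $Z=M$ denotes the event that a measurement of the qubits yields $M$. Let $r=\lceil4(\gamma+1)k^{2\theta}\rceil$ and $\ell'=\lfloor\kappa k\rfloor$, and let $F,G:\{0,1\}^\ell\to\{0,1\}^{\ell'}$ be chosen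 independently and uniformly from two (possibly equal) finite $r$-wise independent families. Consider the protocol in which Alice outputs $A_0=F(S)$ and $A_1=G(T)$, and honest Bob applies $F$ (if $d=0$) or $G$ (if $d=1$) to the string he has decoded. Then, except with probability at most $e^{-c_1k^{2\theta}}$ over the choice of $F$ and $G$, this protocol, which uses the same $m$ qubits, has the following two properties. 1. Correctness: it is correct with error $\eta$, honest Bob using only LOCC operations. 2. Security: for every dishonest Bob performing a separable measurement (in particular, every LOCC Bob), with outcome $Z$, there is a random variable $D\in\{0,1\}$, jointly distributed with $(A_0,A_1,Z)$, such that $$\left\|P_{A_{1-D}A_DDZ}-P_U\times P_{A_DDZ}\right\|_1\le 2^{-(\delta_0k-2(\ell'+1))}+2^{-(\varepsilon_0k-2\ell'+3)}+2^{-(\frac{\alpha}{2}k-2(\ell'+1))}+2^{-(\frac{\alpha}{2}k-2(\ell'+2+\theta\ln k)-\ln(\gamma+1))},$$ where $P_U$ is the uniform distribution on $\{0,1\}^{\ell'}$. Moreover, the right-hand side is at most $2^{-c_2k}$. -/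

import Mathlib

open scoped BigOperators Matrix ComplexOrder

noncomputable section

namespace IsolatedQubits

/-! ### Bit strings, qubits, tensor products of single-qubit operators -/

/-- Bit strings of length `n`. -/
abbrev Bits (n : ℕ) : Type := Fin n → Bool

/-- Operators on a single qubit. -/
abbrev QubitOp : Type := Matrix (Fin 2) (Fin 2) ℂ

/-- Operators on `m` qubits; the computational basis is indexed by `Fin m → Fin 2`. -/
abbrev Op (m : ℕ) : Type := Matrix (Fin m → Fin 2) (Fin m → Fin 2) ℂ

/-- The tensor product `K 0 ⊗ ⋯ ⊗ K (m - 1)` of single-qubit operators. -/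
def tensor {m : ℕ} (K : Fin m → QubitOp) : Op m :=
  Matrix.of fun x y => ∏ j, K j (x j) (y j)

theorem tensor_one {m : ℕ} : tensor (fun _ : Fin m => (1 : QubitOp)) = 1 := by
  ext x y
  simp only [tensor, Matrix.of_apply, Matrix.one_apply]
  by_cases h : x = y
  · subst h; simp
  · rw [if_neg h]
    obtain ⟨j, hj⟩ := Function.ne_iff.mp h
    exact Finset.prod_eq_zero (Finset.mem_univ j) (if_neg hj)

theorem tensor_mul {m : ℕ} (K L : Fin m → QubitOp) :
    tensor (fun j => K j * L j) = tensor K * tensor L := by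
  ext x y
  simp only [tensor, Matrix.of_apply, Matrix.mul_apply, ← Finset.prod_mul_distrib]
  rw [Finset.prod_univ_sum, Fintype.piFinset_univ]

theorem tensor_conjTranspose {m : ℕ} (K : Fin m → QubitOp) :
    (tensor K)ᴴ = tensor (fun j => (K j)ᴴ) := by
  ext x y
  simp [tensor, Matrix.conjTranspose_apply]

/-- The operator `A` acting on qubit `j`, and the identity on all the others. -/
def onQubit {m : ℕ} (j : Fin m) (A : QubitOp) : Fin m → QubitOp :=
  Function.update (fun _ => 1) j A

theorem tensor_onQubit_apply {m : ℕ} (j : Fin m) (A : QubitOp) (x y : Fin m → Fin 2) :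
    tensor (onQubit j A) x y =
      A (x j) (y j) * ∏ i ∈ Finset.univ.erase j, (1 : QubitOp) (x i) (y i) := by
  simp only [tensor, Matrix.of_apply]
  rw [← Finset.mul_prod_erase _ _ (Finset.mem_univ j)]
  congr 1
  · simp [onQubit]
  · refine Finset.prod_congr rfl fun i hi => ?_
    simp [onQubit, Function.update_of_ne (Finset.ne_of_mem_erase hi)]

theorem sum_tensor_onQubit {m n : ℕ} (j : Fin m) (A : Fin n → QubitOp)
    (hA : ∑ a, A a = 1) : ∑ a, tensor (onQubit j (A a)) = 1 := by
  have h1 : tensor (onQubit j (1 : QubitOp)) = 1 := by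
    rw [← tensor_one]; congr 1; ext1 i; simp [onQubit]
  rw [← h1, ← hA]
  ext x y
  rw [Matrix.sum_apply]
  simp only [tensor_onQubit_apply, Matrix.sum_apply, Finset.sum_mul]

/-! ### Separable measurements and LOCC measurements -/

/-- The effect (POVM element) `K† K` of the product Kraus operator `K = ⊗ K_j`. -/
def effectOf {m : ℕ} (K : Fin m → QubitOp) : Op m := (tensor K)ᴴ * tensor K

/-- A separable measurement on `m` qubits with finitely many outcomes: every Kraus operator is
a tensor product of single-qubit operators, and the effects sum to the identity. -/
structure SeparableMeasurement (m : ℕ) where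
  Outcome : Type
  [fintypeOutcome : Fintype Outcome]
  kraus : Outcome → Fin m → QubitOp
  complete : ∑ z, effectOf (kraus z) = 1

attribute [instance] SeparableMeasurement.fintypeOutcome

/-- The effect (POVM element) of outcome `z`. -/
def SeparableMeasurement.effect {m : ℕ} (B : SeparableMeasurement m) (z : B.Outcome) : Op m :=
  effectOf (B.kraus z)

/-- `M` is a separable measurement outcome: an effect `0 ≤ M ≤ 1` that comes from a product
Kraus operator. -/
def IsSeparableOutcome {m : ℕ} (M : Op m) : Prop :=
  (∃ K : Fin m → QubitOp, M = effectOf K) ∧ (1 - M).PosSemidef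

/-- An LOCC strategy on `m` isolated qubits: an adaptive sequence of single-qubit generalized
measurements. Either stop, or measure qubit `j` with Kraus operators `A` and continue in a way
that may depend on the outcome (qubits may be measured repeatedly, in any order; classical
randomness is the case of Kraus operators that are multiples of the identity). -/
inductive LOCC (m : ℕ) : Type where
  | done : LOCC m
  | measure (j : Fin m) (n : ℕ) (A : Fin n → QubitOp) (hA : ∑ a, (A a)ᴴ * A a = 1)
      (next : Fin n → LOCC m) : LOCC m

/-- The transcripts of an LOCC strategy. -/
def LOCC.Outcome {m : ℕ} : LOCC m → Type
  | .done => Unit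
  | .measure _ n _ _ next => Σ a : Fin n, (next a).Outcome

instance LOCC.instFintypeOutcome {m : ℕ} : (B : LOCC m) → Fintype B.Outcome
  | .done => inferInstanceAs (Fintype Unit)
  | .measure _ n _ _ next =>
      letI : ∀ a, Fintype (next a).Outcome := fun a => LOCC.instFintypeOutcome (next a)
      inferInstanceAs (Fintype (Σ a : Fin n, (next a).Outcome))

/-- The product Kraus operator accumulated along a transcript. -/
def LOCC.kraus {m : ℕ} : (B : LOCC m) → B.Outcome → Fin m → QubitOp
  | .done, _ => fun _ => 1
  | .measure j _ A _ next, ⟨a, z⟩ => fun i => (next a).kraus z i * onQubit j (A a) i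

theorem LOCC.complete {m : ℕ} (B : LOCC m) : ∑ z, effectOf (B.kraus z) = 1 := by
  induction B with
  | done =>
    change ∑ _z : Unit, effectOf (fun _ : Fin m => (1 : QubitOp)) = 1
    simp [effectOf, tensor_one]
  | measure j n A hA next ih =>
    change ∑ z : (Σ a : Fin n, (next a).Outcome),
      effectOf (fun i => (next z.1).kraus z.2 i * onQubit j (A z.1) i) = 1
    rw [Fintype.sum_sigma]
    have key : ∀ a : Fin n, ∑ z : (next a).Outcome,
        effectOf (fun i => (next a).kraus z i * onQubit j (A a) i)
          = tensor (onQubit j ((A a)ᴴ * A a)) := by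
      intro a
      have h1 : ∀ z : (next a).Outcome,
          effectOf (fun i => (next a).kraus z i * onQubit j (A a) i)
            = (tensor (onQubit j (A a)))ᴴ * (effectOf ((next a).kraus z)
                * tensor (onQubit j (A a))) := by
        intro z
        simp only [effectOf]
        rw [tensor_mul, Matrix.conjTranspose_mul]
        simp only [Matrix.mul_assoc]
      rw [Finset.sum_congr rfl fun z _ => h1 z, ← Finset.mul_sum, ← Finset.sum_mul, ih a,
        one_mul, tensor_conjTranspose, ← tensor_mul]
      congr 1
      ext1 i
      by_cases hi : i = j
      · subst hi; simp [onQubit]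
      · simp [onQubit, Function.update_of_ne hi]
    rw [Finset.sum_congr rfl fun a _ => key a]
    exact sum_tensor_onQubit j _ hA

/-- Every LOCC strategy is a separable measurement. -/
def LOCC.toSeparable {m : ℕ} (B : LOCC m) : SeparableMeasurement m where
  Outcome := B.Outcome
  kraus := B.kraus
  complete := B.complete

/-- `M` is `δ`-non-negligible for the `m`-qubit state `ρ`: `Tr(M ρ) ≥ δ · Tr(M) / 2 ^ m`. -/
def NonNegligible {m : ℕ} (δ : ℝ) (ρ M : Op m) : Prop :=
  δ * M.trace.re / 2 ^ m ≤ (M * ρ).trace.re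

/-! ### Smooth min-entropy -/

/-- `-log₂ x`, with value `∞` at `x = 0`. -/
def negLog2 (x : ℝ) : EReal := if x = 0 then ⊤ else ((-Real.logb 2 x : ℝ) : EReal)

/-- The smooth min-entropy of a distribution `p` on a finite type, i.e. the supremum over the
events `E` with `P(E) ≥ 1 - ε` of `min_x -log₂ P(E, X = x)`. An event (possibly on an extension of
the probability space) enters only through `q x = P(E, X = x)`, and every `0 ≤ q ≤ p` arises. -/
def smoothMinEntropy {X : Type} [Fintype X] (ε : ℝ) (p : X → ℝ) : EReal :=
  ⨆ (q : X → ℝ) (_ : (∀ x, 0 ≤ q x ∧ q x ≤ p x) ∧ 1 - ε ≤ ∑ x, q x), ⨅ x, negLog2 (q x)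

/-! ### Randomised 1-out-of-2 oblivious transfer in the isolated qubits model -/

/-- A (non-interactive) randomised 1-out-of-2 string OT protocol with `n`-bit messages that uses
`m` qubits: Alice draws her private coins, sends Bob the `m`-qubit state `state ω`, and outputs the
two strings `out false ω` and `out true ω`. Honest Bob with choice bit `d` follows the LOCC
strategy `bob d` and decodes his transcript to an `n`-bit string. -/
structure ROTProtocol (m n : ℕ) where
  Coins : Type
  [fintypeCoins : Fintype Coins]
  prob : Coins → ℝ
  prob_nonneg : ∀ ω, 0 ≤ prob ω
  prob_sum : ∑ ω, prob ω = 1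
  state : Coins → Op m
  state_posSemidef : ∀ ω, (state ω).PosSemidef
  state_trace : ∀ ω, (state ω).trace = 1
  out : Bool → Coins → Bits n
  bob : Bool → LOCC m
  decode : (d : Bool) → (bob d).Outcome → Bits n

attribute [instance] ROTProtocol.fintypeCoins

namespace ROTProtocol

variable {m n : ℕ}

/-- The state of the qubits as seen by someone who does not know Alice's coins. -/
def avgState (P : ROTProtocol m n) : Op m := ∑ ω, (P.prob ω : ℂ) • P.state ω

/-- The joint probability that Alice outputs `(a₀, a₁)` and that a measurement of the qubits
yields the outcome with effect `M`. -/
def jointProb (P : ROTProtocol m n) (M : Op m) (a₀ a₁ : Bits n) : ℝ :=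
  ∑ ω, if P.out false ω = a₀ ∧ P.out true ω = a₁
    then P.prob ω * (M * P.state ω).trace.re else 0

/-- The conditional distribution of Alice's two outputs given the measurement outcome `M`. -/
def condLaw (P : ROTProtocol m n) (M : Op m) : Bits n × Bits n → ℝ := fun a =>
  P.jointProb M a.1 a.2 / (M * P.avgState).trace.re

/-- Correctness with error `η`: for each choice bit `d`, honest Bob's (LOCC) output equals Alice's
string number `d`, except with probability `η`. -/
def Correct (P : ROTProtocol m n) (η : ℝ) : Prop :=
  ∀ d : Bool, 1 - η ≤ ∑ ω, ∑ z : (P.bob d).Outcome,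
    if P.decode d z = P.out d ω
      then P.prob ω * ((P.bob d).toSeparable.effect z * P.state ω).trace.re else 0

/-- "Leaky" security: given any (nonzero) separable measurement outcome that is
`δ`-non-negligible, the pair of Alice's outputs has `ε`-smooth min-entropy at least `h`. -/
def LeakySecure (P : ROTProtocol m n) (δ ε h : ℝ) : Prop :=
  ∀ M : Op m, IsSeparableOutcome M → M ≠ 0 → NonNegligible δ P.avgState M →
    (h : EReal) ≤ smoothMinEntropy ε (P.condLaw M)

/-- The protocol in which Alice outputs `(F(s), G(t))` instead of `(s, t)`, and Bob applies `F`
or `G`, according to his choice, to the string that he has obtained. -/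
def hash {n' : ℕ} (P : ROTProtocol m n) (F G : Bits n → Bits n') : ROTProtocol m n' where
  Coins := P.Coins
  prob := P.prob
  prob_nonneg := P.prob_nonneg
  prob_sum := P.prob_sum
  state := P.state
  state_posSemidef := P.state_posSemidef
  state_trace := P.state_trace
  out := fun d ω => if d then G (P.out true ω) else F (P.out false ω)
  bob := P.bob
  decode := fun d z => if d then G (P.decode d z) else F (P.decode d z)

/-- `Q d a₀ a₁ z = P(D = d, A₀ = a₀, A₁ = a₁, Z = z)` is the joint law of Alice's outputs, the
outcome `Z` of the measurement `B`, and some binary random variable `D` (arbitrarily correlated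
with the rest). -/
def IsJointLawWithBit (P : ROTProtocol m n) (B : SeparableMeasurement m)
    (Q : Bool → Bits n → Bits n → B.Outcome → ℝ) : Prop :=
  (∀ d a₀ a₁ z, 0 ≤ Q d a₀ a₁ z) ∧
    ∀ a₀ a₁ z, ∑ d, Q d a₀ a₁ z = P.jointProb (B.effect z) a₀ a₁

end ROTProtocol

/-- From the joint law `Q` of `(D, A₀, A₁, Z)`, the probability
`P(A_{1-D} = a, A_D = b, D = d, Z = z)`. -/
def reordered {n : ℕ} {Z : Type} (Q : Bool → Bits n → Bits n → Z → ℝ)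
    (a b : Bits n) (d : Bool) (z : Z) : ℝ :=
  if d then Q true a b z else Q false b a z

/-- The `ℓ₁` distance `‖P_{A_{1-D} A_D D Z} - P_U × P_{A_D D Z}‖₁`, with `U` uniform on `n`-bit
strings. -/
def distFromOblivious {n : ℕ} {Z : Type} [Fintype Z]
    (Q : Bool → Bits n → Bits n → Z → ℝ) : ℝ :=
  ∑ a, ∑ b, ∑ d, ∑ z, |reordered Q a b d z - (1 / 2 ^ n) * ∑ a', reordered Q a' b d z|

/-- Security for honest Alice with error `e`: for every dishonest Bob there is a binary random
variable `D` such that `A_{1-D}` is `e`-close to uniform and independent of `(A_D, D, Z)`.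
Dishonest Bob may perform any separable measurement; by `LOCC.toSeparable` this includes all LOCC
strategies. -/
def ROTProtocol.SecureForAlice {m n : ℕ} (P : ROTProtocol m n) (e : ℝ) : Prop :=
  ∀ B : SeparableMeasurement m, ∃ Q : Bool → Bits n → Bits n → B.Outcome → ℝ,
    P.IsJointLawWithBit B Q ∧ distFromOblivious Q ≤ e

/-! ### Hash families -/

/-- The probability of an event when an element of a finite type is drawn uniformly. -/
def unifProb {I : Type} (E : Set I) : ℝ := (E.ncard : ℝ) / (Nat.card I : ℝ)

/-- The family `h` of functions `X → Y` is `r`-wise independent: if `i` is drawn uniformly, then for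
every set `S` of at most `r` points, the values `h i x`, `x ∈ S`, are independent and uniform on `Y`,
i.e. they take any prescribed values with probability `|Y| ^ (-|S|)`. -/
def WiseIndependent {I X Y : Type} (r : ℕ) (h : I → X → Y) : Prop :=
  ∀ S : Finset X, S.card ≤ r → ∀ y : X → Y,
    unifProb {i | ∀ x ∈ S, h i x = y x} = (1 / (Nat.card Y : ℝ)) ^ S.card

/-! ### The explicit error bound -/

/-- The explicit bound on the distance from ideal, for output length `l'`. -/
def errorBound (θ δ₀ α ε₀ γ : ℝ) (k l' : ℕ) : ℝ :=
  (2 : ℝ) ^ (-(δ₀ * k - 2 * (l' + 1))) + (2 : ℝ) ^ (-(ε₀ * k - 2 * l' + 3))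
    + (2 : ℝ) ^ (-(α / 2 * k - 2 * (l' + 1)))
    + (2 : ℝ) ^ (-(α / 2 * k - 2 * (l' + 2 + θ * Real.log k) - Real.log (γ + 1)))

end IsolatedQubits

end

/-! Fix the hash functions and a measurement outcome with effect `M`, and consider the joint law of
the hashed strings `(A₀, A₁)` on that outcome. If its Fourier coefficients at all pairs `(u, v)` of
nontrivial Walsh characters vanished, it would be a sum `f A₀ + g A₁`; after shifting the minimum of
`f` to `0` both summands are nonnegative, and letting `D` choose between them makes `A₁` uniform
given `A₀` on the first part, and `A₀` uniform given `A₁` on the second. If the coefficients are only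
bounded by `β`, the same construction works with an `ℓ₁` error of `4 N ^ (3 / 2) β`, where
`N = 2 ^ l'` (`exists_split`). The explicit bound allows a factor of order `N ^ 2`; the spare
`√N` is exponential in `k` and pays for every polynomial loss.

The coefficient at `(u, v)` is a quadratic form `∑ q(s, t) (-1) ^ (u · F s) (-1) ^ (v · G t)` in two
independent families of `r`-wise independent signs, where, after smoothing, `q` is pointwise at most
about `2 ^ (-α k)`. Moments of order up to `r` agree with those for truly random functions, so two
applications of Khintchine's inequality (`WiseIndependent.chaos_moment_le`) and Markov's inequality
show that the coefficient exceeds `O(r ^ 2) 2 ^ (-α k / 2)` with probability at most about `2 ^ (-r)`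
(`ROTProtocol.unifProb_bias_le`).

To treat all measurements at once, rescale the outcomes so that every factor has trace `1`, and
round the entries of the factors to precision `2 ^ (-O(m))`. Product operators have only `O(m)`
parameters, so this gives a net of `2 ^ O(m ^ 2) ≤ 2 ^ O(k ^ (2 θ))` outcomes (`exists_net`), over
which the union bound is taken; this is what determines `γ`. Non-negligible outcomes inherit the
bound from the net, negligible ones contribute `δ` in total because the traces of the effects sum to
`2 ^ m` (`ROTProtocol.secureForAlice_of_bias_le`). -/

noncomputable section

namespace IsolatedQubits

open Finset

/-! ### Uniform probabilities -/

theorem unifProb_mono {I : Type} [Finite I] {E E' : Set I} (h : E ⊆ E') :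
    unifProb E ≤ unifProb E' := by
  unfold unifProb
  have := Set.ncard_le_ncard h (Set.toFinite E')
  gcongr

theorem unifProb_iUnion_le {I C : Type} [Finite I] [Fintype C] (E : C → Set I) :
    unifProb (⋃ c, E c) ≤ ∑ c, unifProb (E c) := by
  unfold unifProb
  rw [← Finset.sum_div]
  gcongr
  exact_mod_cast Set.ncard_iUnion_le_of_fintype E

theorem unifProb_eq_expect {I : Type} [Fintype I] (E : Set I) [DecidablePred (· ∈ E)] :
    unifProb E = 𝔼 i, if i ∈ E then (1 : ℝ) else 0 := by
  rw [Fintype.expect_eq_sum_div_card, unifProb, Nat.card_eq_fintype_card,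
    Set.ncard_eq_toFinset_card', Finset.sum_boole, Set.filter_mem_univ_eq_toFinset]

/-- Markov's inequality for an even power. -/
theorem unifProb_lt_abs_le {I : Type} [Fintype I] (f : I → ℝ) {t : ℝ} (ht : 0 < t) (p : ℕ) :
    unifProb {i | t < |f i|} ≤ (𝔼 i, f i ^ (2 * p)) / t ^ (2 * p) := by
  classical
  rw [unifProb_eq_expect, Finset.expect_div]
  refine Finset.expect_le_expect fun i _ => ?_
  split_ifs with h
  · rw [le_div_iff₀ (by positivity), one_mul, ← (even_two_mul p).pow_abs (f i)]
    exact pow_le_pow_left₀ ht.le h.le _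
  · rw [pow_mul (f i)]
    positivity

/-! ### Moments of sums over a family of limited independence -/

section Moments

variable {I X Y : Type} [Fintype I] [Fintype X] [Fintype Y] [DecidableEq X]

theorem card_agreeing [DecidableEq Y] (S : Finset X) (y : X → Y) :
    (#{f : X → Y | ∀ x ∈ S, f x = y x} : ℝ) * (Fintype.card Y : ℝ) ^ #S
      = (Fintype.card Y : ℝ) ^ Fintype.card X := by
  have h : ({f : X → Y | ∀ x ∈ S, f x = y x} : Finset (X → Y))
      = Fintype.piFinset fun x => if x ∈ S then {y x} else univ := by
    ext f
    simp only [mem_filter, mem_univ, true_and, Fintype.mem_piFinset]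
    refine forall_congr' fun x => ?_
    split_ifs with hx <;> simp [hx]
  rw [h, Fintype.card_piFinset]
  have h2 : ∀ x, #(if x ∈ S then {y x} else univ : Finset Y)
      = if x ∈ S then 1 else Fintype.card Y := fun x => by split_ifs <;> simp
  simp only [h2]
  rw [← Finset.card_univ (α := X), ← Finset.prod_const, ← Finset.prod_const]
  push_cast
  rw [← Finset.prod_mul_prod_compl S, Finset.prod_ite_of_true (by simp),
    Finset.prod_ite_of_false (by simp), ← Finset.prod_mul_prod_compl S (fun _ => (_ : ℝ))]
  simp
  ring

/-- A function of at most `r` values has the same mean under an `r`-wise independent family as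
under a uniformly random function. -/
theorem WiseIndependent.expect_eq [Nonempty Y] {r : ℕ} {h : I → X → Y} (hh : WiseIndependent r h)
    {S : Finset X} (hS : #S ≤ r) (Φ : (X → Y) → ℝ)
    (hΦ : ∀ f g : X → Y, (∀ x ∈ S, f x = g x) → Φ f = Φ g) :
    𝔼 i, Φ (h i) = 𝔼 f : X → Y, Φ f := by
  classical
  have hY : (0 : ℝ) < Fintype.card Y := by exact_mod_cast Fintype.card_pos
  -- Both sides are evaluated by averaging over the pairs `(i, f)` that agree on `S`.
  have h1 : ∀ i, (∑ f : X → Y, if ∀ x ∈ S, h i x = f x then Φ f else 0)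
      = #{f : X → Y | ∀ x ∈ S, f x = h i x} * Φ (h i) := by
    intro i
    rw [← Finset.sum_filter, ← nsmul_eq_mul, ← Finset.sum_const]
    refine Finset.sum_congr ?_ fun f hf => ?_
    · ext f; simp [eq_comm]
    · exact hΦ _ _ (by simpa using hf)
  have h2 : ∀ f : X → Y, (𝔼 i, if ∀ x ∈ S, h i x = f x then Φ f else 0)
      = Φ f * (1 / (Fintype.card Y : ℝ)) ^ #S := by
    intro f
    rw [← Nat.card_eq_fintype_card, ← hh S hS f, unifProb_eq_expect, Finset.mul_expect]
    refine Finset.expect_congr rfl fun i _ => ?_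
    simp
  have h3 : 𝔼 i, (∑ f : X → Y, if ∀ x ∈ S, h i x = f x then Φ f else 0)
      = ∑ f : X → Y, Φ f * (1 / (Fintype.card Y : ℝ)) ^ #S := by
    rw [Finset.expect_sum_comm]
    exact Finset.sum_congr rfl fun f _ => h2 f
  have h4 : 𝔼 i, (∑ f : X → Y, if ∀ x ∈ S, h i x = f x then Φ f else 0)
      = ((Fintype.card Y : ℝ) ^ Fintype.card X / (Fintype.card Y : ℝ) ^ #S) * 𝔼 i, Φ (h i) := by
    rw [Finset.mul_expect]
    refine Finset.expect_congr rfl fun i _ => ?_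
    rw [h1, ← card_agreeing S (h i), mul_div_cancel_right₀ _ (by positivity)]
  rw [Fintype.expect_eq_sum_div_card (ι := X → Y), Fintype.card_fun, eq_div_iff (by positivity)]
  rw [h4, ← Finset.sum_mul, div_mul_eq_mul_div, div_eq_iff (by positivity), one_div, inv_pow,
    inv_mul_cancel_right₀ (by positivity)] at h3
  push_cast
  linarith

theorem WiseIndependent.expect_pow_eq [Nonempty Y] {r : ℕ} {h : I → X → Y}
    (hh : WiseIndependent r h) (φ : Y → ℝ) (c : X → ℝ) {n : ℕ} (hn : n ≤ r) :
    𝔼 i, (∑ x, c x * φ (h i x)) ^ n = 𝔼 f : X → Y, (∑ x, c x * φ (f x)) ^ n := by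
  simp only [Fintype.sum_pow]
  rw [Finset.expect_sum_comm, Finset.expect_sum_comm]
  refine Finset.sum_congr rfl fun t _ => ?_
  refine hh.expect_eq (S := univ.image t) (Finset.card_image_le.trans (by simpa using hn))
    (fun f => ∏ j, c (t j) * φ (f (t j))) fun f g hfg => ?_
  exact Finset.prod_congr rfl fun j _ => by rw [hfg (t j) (by simp)]

theorem expect_exp_sum_le {φ : Y → ℝ} (hφ : ∀ c : ℝ, 𝔼 y, Real.exp (c * φ y) ≤ Real.exp (c ^ 2 / 2))
    (c : X → ℝ) :
    𝔼 f : X → Y, Real.exp (∑ x, c x * φ (f x)) ≤ Real.exp ((∑ x, c x ^ 2) / 2) := by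
  have h : 𝔼 f : X → Y, Real.exp (∑ x, c x * φ (f x)) = ∏ x, 𝔼 y, Real.exp (c x * φ y) := by
    simp only [Fintype.expect_eq_sum_div_card, Real.exp_sum, Finset.prod_div_distrib,
      Finset.prod_const, Fintype.card_fun, Finset.card_univ]
    rw [Finset.prod_univ_sum, Fintype.piFinset_univ]
    push_cast
    rfl
  rw [h, Finset.sum_div, Real.exp_sum]
  exact Finset.prod_le_prod (fun x _ => Finset.expect_nonneg fun y _ => (Real.exp_pos _).le)
    fun x _ => hφ (c x)

/-- Khintchine's inequality, with a crude constant, for a subgaussian function of the values of a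
family of limited independence. The moment of order `2 p` sees at most `2 p` values at a time, so
it may be computed for a uniformly random function. -/
theorem WiseIndependent.khintchine [Nonempty Y] {r : ℕ} {h : I → X → Y} (hh : WiseIndependent r h)
    {φ : Y → ℝ} (hφ : ∀ c : ℝ, 𝔼 y, Real.exp (c * φ y) ≤ Real.exp (c ^ 2 / 2))
    (c : X → ℝ) {p : ℕ} (hp : 2 * p ≤ r) :
    𝔼 i, (∑ x, c x * φ (h i x)) ^ (2 * p) ≤ 4 * (2 * p).factorial * (∑ x, c x ^ 2) ^ p := by
  rw [hh.expect_pow_eq φ c hp]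
  rcases (Finset.sum_nonneg fun x _ => sq_nonneg (c x)).eq_or_lt' with h0 | hpos
  · have hc : ∀ x, c x = 0 := fun x => by
      have := (Finset.sum_eq_zero_iff_of_nonneg fun x _ => sq_nonneg (c x)).1 h0 x (mem_univ x)
      simpa using this
    rcases Nat.eq_zero_or_pos p with rfl | hp0
    · simp
    · simp [hc, hp0.ne']
  · set σ := Real.sqrt (∑ x, c x ^ 2) with hσ
    have hσ0 : 0 < σ := Real.sqrt_pos.2 hpos
    have hσ2 : σ ^ 2 = ∑ x, c x ^ 2 := Real.sq_sqrt hpos.le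
    have hunit : ∑ x, (c x / σ) ^ 2 = 1 := by
      simp only [div_pow]
      rw [← Finset.sum_div, ← hσ2, div_self (by positivity)]
    have hpt : ∀ f : X → Y, (∑ x, c x * φ (f x)) ^ (2 * p) ≤ (2 * p).factorial * σ ^ (2 * p) *
        (Real.exp (∑ x, c x / σ * φ (f x)) + Real.exp (∑ x, -(c x / σ) * φ (f x))) := by
      intro f
      set z := ∑ x, c x / σ * φ (f x) with hz
      have h1 : ∑ x, c x * φ (f x) = σ * z := by
        rw [hz, Finset.mul_sum]
        exact Finset.sum_congr rfl fun x _ => by field_simp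
      have h2 : ∑ x, -(c x / σ) * φ (f x) = -z := by
        rw [hz, ← Finset.sum_neg_distrib]
        exact Finset.sum_congr rfl fun x _ => by ring
      have h3 := Real.pow_div_factorial_le_exp |z| (abs_nonneg z) (2 * p)
      rw [div_le_iff₀ (by positivity), (even_two_mul p).pow_abs] at h3
      have h4 : Real.exp |z| ≤ Real.exp z + Real.exp (-z) := by
        rcases abs_choice z with h | h <;> rw [h] <;> linarith [Real.exp_pos z, Real.exp_pos (-z)]
      rw [h1, h2, mul_pow]
      calc σ ^ (2 * p) * z ^ (2 * p)
          ≤ σ ^ (2 * p) * ((Real.exp z + Real.exp (-z)) * (2 * p).factorial) := by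
            gcongr
            exact h3.trans (by gcongr)
        _ = _ := by ring
    refine (Finset.expect_le_expect fun f _ => hpt f).trans ?_
    rw [← Finset.mul_expect, Finset.expect_add_distrib]
    have e1 := expect_exp_sum_le hφ fun x => c x / σ
    have e2 := expect_exp_sum_le hφ fun x => -(c x / σ)
    simp only [neg_sq, hunit] at e1 e2
    have e3 : Real.exp (1 / 2) ≤ 2 := by
      have := Real.exp_one_lt_d9
      have h2 : Real.exp (1 / 2) ^ 2 = Real.exp 1 := by rw [← Real.exp_nat_mul]; norm_num
      nlinarith [Real.exp_pos (1 / 2)]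
    rw [← hσ2, ← pow_mul]
    calc _ ≤ (2 * p).factorial * σ ^ (2 * p) * (2 + 2) := by
            gcongr
            · exact e1.trans e3
            · exact e2.trans e3
      _ = _ := by ring

theorem expect_sum_sq_pow_le {T : Type} [Fintype T] (c : I → T → ℝ) (w : T → ℝ)
    (hw : ∀ t, 0 ≤ w t) {A : ℝ} (hA : 0 ≤ A) {p : ℕ} (hp : p ≠ 0)
    (h : ∀ t, 𝔼 i, c i t ^ (2 * p) ≤ A * w t ^ p) (h0 : ∀ t, w t = 0 → ∀ i, c i t = 0) :
    𝔼 i, (∑ t, c i t ^ 2) ^ p ≤ A * (∑ t, w t) ^ p := by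
  set W := ∑ t, w t with hW
  rcases (Finset.sum_nonneg fun t _ => hw t).eq_or_lt' with hz | hpos
  · have hc : ∀ i t, c i t = 0 := fun i t =>
      h0 t ((Finset.sum_eq_zero_iff_of_nonneg fun t _ => hw t).1 hz t (mem_univ t)) i
    simp only [hc]
    simp [hp]
    rw [hW, hz, zero_pow hp, mul_zero]
  rw [← hW] at hpos
  -- Jensen's inequality with the weights `w t / W`.
  have hpt : ∀ i, (∑ t, c i t ^ 2) ^ p ≤ ∑ t, w t / W * (c i t ^ 2 * (W / w t)) ^ p := by
    intro i
    have := Real.pow_arith_mean_le_arith_mean_pow univ (fun t => w t / W)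
      (fun t => c i t ^ 2 * (W / w t)) (fun t _ => div_nonneg (hw t) hpos.le)
      (by rw [← Finset.sum_div, div_self hpos.ne'])
      (fun t _ => mul_nonneg (sq_nonneg _) (div_nonneg hpos.le (hw t))) p
    refine le_of_eq_of_le ?_ this
    congr 1
    refine Finset.sum_congr rfl fun t _ => ?_
    by_cases ht : w t = 0
    · simp [h0 t ht i]
    · field_simp
  refine (Finset.expect_le_expect fun i _ => hpt i).trans ?_
  rw [Finset.expect_sum_comm]
  calc ∑ t, 𝔼 i, w t / W * (c i t ^ 2 * (W / w t)) ^ p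
      ≤ ∑ t, w t / W * (A * W ^ p) := by
        refine Finset.sum_le_sum fun t _ => ?_
        rw [← Finset.mul_expect]
        refine mul_le_mul_of_nonneg_left ?_ (div_nonneg (hw t) hpos.le)
        simp only [mul_pow, ← pow_mul]
        rw [← Finset.expect_mul]
        by_cases ht : w t = 0
        · simp [ht, hp]; positivity
        · refine (mul_le_mul_of_nonneg_right (h t)
            (pow_nonneg (div_nonneg hpos.le (hw t)) _)).trans (le_of_eq ?_)
          rw [mul_assoc, ← mul_pow, mul_div_cancel₀ W ht]
    _ = A * W ^ p := by
        rw [← Finset.sum_mul, ← Finset.sum_div, div_self hpos.ne', one_mul]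

/-- Moments of a decoupled quadratic form in two independent families of limited independence:
Khintchine's inequality is applied first in the second family, and then in the first. -/
theorem WiseIndependent.chaos_moment_le {J X' Y' : Type} [Fintype J] [Fintype X'] [Fintype Y']
    [DecidableEq X'] [Nonempty Y] [Nonempty Y'] {r : ℕ}
    {F : I → X → Y} {G : J → X' → Y'} (hF : WiseIndependent r F) (hG : WiseIndependent r G)
    {φ : Y → ℝ} (hφ : ∀ c : ℝ, 𝔼 y, Real.exp (c * φ y) ≤ Real.exp (c ^ 2 / 2))
    {ψ : Y' → ℝ} (hψ : ∀ c : ℝ, 𝔼 y, Real.exp (c * ψ y) ≤ Real.exp (c ^ 2 / 2))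
    (q : X → X' → ℝ) {p : ℕ} (hp : p ≠ 0) (hpr : 2 * p ≤ r) :
    𝔼 f : I × J, (∑ s, ∑ t, q s t * (φ (F f.1 s) * ψ (G f.2 t))) ^ (2 * p)
      ≤ (4 * (2 * p).factorial) ^ 2 * (∑ s, ∑ t, q s t ^ 2) ^ p := by
  rw [← Finset.univ_product_univ, Finset.expect_product]
  have h1 : ∀ i, 𝔼 j, (∑ s, ∑ t, q s t * (φ (F i s) * ψ (G j t))) ^ (2 * p)
      ≤ 4 * (2 * p).factorial * (∑ t, (∑ s, q s t * φ (F i s)) ^ 2) ^ p := by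
    intro i
    refine le_of_eq_of_le ?_ (hG.khintchine hψ (fun t => ∑ s, q s t * φ (F i s)) hpr)
    refine Finset.expect_congr rfl fun j _ => ?_
    congr 1
    rw [Finset.sum_comm]
    refine Finset.sum_congr rfl fun t _ => ?_
    rw [Finset.sum_mul]
    exact Finset.sum_congr rfl fun s _ => by ring
  refine (Finset.expect_le_expect fun i _ => h1 i).trans ?_
  rw [← Finset.mul_expect]
  have h2 := expect_sum_sq_pow_le (fun i t => ∑ s, q s t * φ (F i s)) (fun t => ∑ s, q s t ^ 2)
    (fun t => Finset.sum_nonneg fun s _ => sq_nonneg _)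
    (A := 4 * (2 * p).factorial) (by positivity) hp
    (fun t => hF.khintchine hφ (fun s => q s t) hpr)
    (fun t ht i => by
      refine Finset.sum_eq_zero fun s _ => ?_
      have := (Finset.sum_eq_zero_iff_of_nonneg fun s _ => sq_nonneg (q s t)).1 ht s (mem_univ s)
      rw [pow_eq_zero_iff two_ne_zero] at this
      rw [this, zero_mul])
  rw [Finset.sum_comm (f := fun s t => q s t ^ 2), sq (4 * _ : ℝ), mul_assoc (4 * _ : ℝ)]
  exact mul_le_mul_of_nonneg_left h2 (by positivity)

end Moments

/-! ### Walsh characters -/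

/-- The Walsh character `(-1) ^ (u · a)` of the group of bit strings. -/
def walsh {n : ℕ} (u a : Bits n) : ℝ := ∏ j, if u j && a j then -1 else 1

theorem walsh_comm {n : ℕ} (u a : Bits n) : walsh u a = walsh a u := by
  simp only [walsh, Bool.and_comm]

theorem walsh_zero {n : ℕ} (a : Bits n) : walsh (fun _ => false) a = 1 := by
  simp [walsh]

theorem walsh_eq_or {n : ℕ} (u a : Bits n) : walsh u a = 1 ∨ walsh u a = -1 := by
  unfold walsh
  induction (univ : Finset (Fin n)) using Finset.induction_on with
  | empty => simp
  | insert j s hj ih =>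
    rw [Finset.prod_insert hj]
    rcases ih with h | h <;> rw [h] <;> split_ifs <;> simp

theorem abs_walsh {n : ℕ} (u a : Bits n) : |walsh u a| = 1 := by
  rcases walsh_eq_or u a with h | h <;> simp [h]

theorem sum_walsh_mul_walsh {n : ℕ} (u v : Bits n) :
    ∑ a, walsh u a * walsh v a = if u = v then (2 : ℝ) ^ n else 0 := by
  simp only [walsh, ← Finset.prod_mul_distrib]
  have h := (Finset.prod_univ_sum (fun _ : Fin n => (univ : Finset Bool)) fun j b =>
    (if u j && b then (-1 : ℝ) else 1) * (if v j && b then -1 else 1)).symm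
  rw [Fintype.piFinset_univ] at h
  rw [h]
  have h2 : ∀ j, ∑ b : Bool, (if u j && b then (-1 : ℝ) else 1) * (if v j && b then -1 else 1)
      = if u j = v j then 2 else 0 := by
    intro j
    cases u j <;> cases v j <;> norm_num
  rw [Finset.prod_congr rfl fun j _ => h2 j]
  split_ifs with huv
  · subst huv; simp
  · obtain ⟨j, hj⟩ := Function.ne_iff.mp huv
    exact Finset.prod_eq_zero (mem_univ j) (if_neg hj)

/-- A nontrivial Walsh character of a uniformly random string is a uniformly random sign, hence
subgaussian. -/
theorem expect_exp_walsh_le {n : ℕ} {u : Bits n} (hu : u ≠ fun _ => false) (c : ℝ) :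
    𝔼 y, Real.exp (c * walsh u y) ≤ Real.exp (c ^ 2 / 2) := by
  have h : ∀ y, Real.exp (c * walsh u y) = Real.cosh c + walsh u y * Real.sinh c := by
    intro y
    rcases walsh_eq_or u y with h | h <;> rw [h]
    · rw [mul_one, one_mul, Real.cosh_add_sinh]
    · rw [mul_neg_one, neg_one_mul, ← sub_eq_add_neg, Real.cosh_sub_sinh]
  have h0 : ∑ y, walsh u y = 0 := by
    have := sum_walsh_mul_walsh u fun _ => false
    simpa [walsh_zero, hu] using this
  simp only [h]
  rw [Finset.expect_add_distrib, ← Finset.expect_mul, Fintype.expect_eq_sum_div_card (walsh u), h0,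
    zero_div, zero_mul, add_zero, Fintype.expect_const]
  exact Real.cosh_le_exp_half_sq c

/-! ### Splitting a nearly additive distribution -/

/-- The Fourier coefficient of `p` at the pair of characters `(u, v)`. -/
def fourier {n : ℕ} (p : Bits n → Bits n → ℝ) (u v : Bits n) : ℝ :=
  ∑ a, ∑ b, p a b * (walsh u a * walsh v b)

theorem fourier_inversion {n : ℕ} (p : Bits n → Bits n → ℝ) (a b : Bits n) :
    ∑ u, ∑ v, fourier p u v * (walsh u a * walsh v b) = (2 ^ n) ^ 2 * p a b := by
  have h : ∀ u v, fourier p u v * (walsh u a * walsh v b)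
      = ∑ x : Bits n × Bits n, p x.1 x.2 * ((walsh x.1 u * walsh a u) * (walsh x.2 v * walsh b v)) := by
    intro u v
    rw [fourier, Fintype.sum_prod_type, Finset.sum_mul]
    refine Finset.sum_congr rfl fun x _ => ?_
    rw [Finset.sum_mul]
    refine Finset.sum_congr rfl fun y _ => ?_
    rw [walsh_comm x u, walsh_comm a u, walsh_comm y v, walsh_comm b v]
    ring
  simp only [h]
  simp only [fun u => Finset.sum_comm (s := univ) (t := univ) (γ := Bits n)
    (f := fun v (x : Bits n × Bits n) =>
      p x.1 x.2 * ((walsh x.1 u * walsh a u) * (walsh x.2 v * walsh b v)))]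
  rw [Finset.sum_comm]
  simp only [← Finset.mul_sum, ← Finset.sum_mul, sum_walsh_mul_walsh]
  rw [Fintype.sum_prod_type]
  rw [Finset.sum_eq_single a (fun x _ hx => Finset.sum_eq_zero fun y _ => by simp [hx])
    (by simp), Finset.sum_eq_single b (fun y _ hy => by simp [hy]) (by simp)]
  simp
  ring

/-- If all Fourier coefficients of `p` at pairs of nontrivial characters are at most `β`, then `p`
is, up to an error with small `ℓ₂` norm, the sum of a function of the first variable and a function
of the second. -/
theorem exists_additive_approx {n : ℕ} (p : Bits n → Bits n → ℝ) {β : ℝ}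
    (hβ : ∀ u v : Bits n, u ≠ (fun _ => false) → v ≠ (fun _ => false) → |fourier p u v| ≤ β) :
    ∃ f g : Bits n → ℝ, ∑ a, ∑ b, (p a b - (f a + g b)) ^ 2 ≤ β ^ 2 := by
  set o : Bits n := fun _ => false with ho
  set N : ℝ := 2 ^ n with hN
  have hN0 : 0 < N := by positivity
  set c : Bits n → Bits n → ℝ := fun u v => if u = o ∨ v = o then 0 else fourier p u v with hc
  set f : Bits n → ℝ := fun a => (∑ u, fourier p u o * walsh u a) / N ^ 2
  set g : Bits n → ℝ := fun b => (∑ v, (if v = o then 0 else fourier p o v) * walsh v b) / N ^ 2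
  refine ⟨f, g, ?_⟩
  have hβ0 : ∀ u v, c u v ^ 2 ≤ β ^ 2 := by
    intro u v
    simp only [hc]
    split_ifs with h
    · rw [zero_pow two_ne_zero]; positivity
    · push Not at h
      exact sq_le_sq.2 ((hβ u v h.1 h.2).trans (le_abs_self β))
  have herr : ∀ a b, p a b - (f a + g b)
      = (∑ x : Bits n × Bits n, c x.1 x.2 * (walsh x.1 a * walsh x.2 b)) / N ^ 2 := by
    intro a b
    have hsplit : ∀ u v, fourier p u v * (walsh u a * walsh v b)
        = c u v * (walsh u a * walsh v b)
          + ((if v = o then fourier p u o * walsh u a else 0)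
          + (if u = o then (if v = o then 0 else fourier p o v) * walsh v b else 0)) := by
      intro u v
      have hwo : ∀ a, walsh o a = 1 := walsh_zero
      by_cases hu : u = o <;> by_cases hv : v = o <;> simp [hc, hu, hv, hwo]
    have hinv := fourier_inversion p a b
    simp only [hsplit, Finset.sum_add_distrib] at hinv
    rw [Finset.sum_comm (f := fun u v => if u = o then _ else _)] at hinv
    simp only [Finset.sum_ite_eq', mem_univ, if_true] at hinv
    rw [← hN] at hinv
    rw [Fintype.sum_prod_type, eq_div_iff (by positivity)]
    simp only [f, g]
    rw [← add_div, sub_mul, div_mul_cancel₀ _ (by positivity)]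
    linarith
  simp only [herr, div_pow]
  simp only [← Finset.sum_div]
  -- Parseval's identity
  have hpars : ∑ a, ∑ b, (∑ x : Bits n × Bits n, c x.1 x.2 * (walsh x.1 a * walsh x.2 b)) ^ 2
      = N ^ 2 * ∑ x : Bits n × Bits n, c x.1 x.2 ^ 2 := by
    have h1 : ∀ x y : Bits n × Bits n,
        ∑ ab : Bits n × Bits n, (c x.1 x.2 * (walsh x.1 ab.1 * walsh x.2 ab.2)) *
          (c y.1 y.2 * (walsh y.1 ab.1 * walsh y.2 ab.2))
        = if x = y then N ^ 2 * c x.1 x.2 ^ 2 else 0 := by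
      intro x y
      have : ∀ ab : Bits n × Bits n, (c x.1 x.2 * (walsh x.1 ab.1 * walsh x.2 ab.2)) *
          (c y.1 y.2 * (walsh y.1 ab.1 * walsh y.2 ab.2))
          = c x.1 x.2 * c y.1 y.2 * ((walsh x.1 ab.1 * walsh y.1 ab.1) *
            (walsh x.2 ab.2 * walsh y.2 ab.2)) := fun ab => by ring
      simp only [this]
      rw [← Finset.mul_sum, Fintype.sum_prod_type]
      simp only [← Finset.mul_sum, ← Finset.sum_mul, sum_walsh_mul_walsh]
      by_cases h : x = y
      · subst h; simp; ring
      · rw [if_neg h]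
        by_cases h1 : x.1 = y.1
        · have h2 : x.2 ≠ y.2 := fun h2 => h (Prod.ext h1 h2)
          simp [h2]
        · simp [h1]
    rw [← Fintype.sum_prod_type' (f := fun a b =>
      (∑ x : Bits n × Bits n, c x.1 x.2 * (walsh x.1 a * walsh x.2 b)) ^ 2)]
    simp only [sq (∑ x : Bits n × Bits n, _), Finset.sum_mul_sum]
    rw [Finset.sum_comm, Finset.mul_sum]
    refine Finset.sum_congr rfl fun x _ => ?_
    rw [Finset.sum_comm]
    simp only [h1]
    simp
  rw [hpars, div_le_iff₀ (by positivity)]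
  have hcard : (Fintype.card (Bits n × Bits n) : ℝ) = N ^ 2 := by
    simp [hN, sq]
  calc N ^ 2 * ∑ x : Bits n × Bits n, c x.1 x.2 ^ 2
      ≤ N ^ 2 * ∑ _x : Bits n × Bits n, β ^ 2 :=
        mul_le_mul_of_nonneg_left (Finset.sum_le_sum fun x _ => hβ0 x.1 x.2) (by positivity)
    _ = β ^ 2 * (N ^ 2) ^ 2 := by
        rw [Finset.sum_const, nsmul_eq_mul, Finset.card_univ, hcard]; ring

theorem sum_abs_sub_average_le {n : ℕ} (q : Bits n → ℝ) (r : ℝ) :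
    ∑ a, |q a - 1 / 2 ^ n * ∑ a', q a'| ≤ 2 * ∑ a, |q a - r| := by
  set N : ℝ := 2 ^ n with hN
  have hN0 : 0 < N := by positivity
  have hcard : (Fintype.card (Bits n) : ℝ) = N := by simp [hN]
  have h1 : |r - 1 / N * ∑ a', q a'| ≤ 1 / N * ∑ a, |q a - r| := by
    have : r - 1 / N * ∑ a', q a' = - (1 / N * ∑ a, (q a - r)) := by
      rw [Finset.sum_sub_distrib, Finset.sum_const, nsmul_eq_mul, Finset.card_univ, hcard]
      field_simp
      ring
    rw [this, abs_neg, abs_mul, abs_of_pos (by positivity : 0 < 1 / N)]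
    gcongr
    exact Finset.abs_sum_le_sum_abs _ _
  calc ∑ a, |q a - 1 / N * ∑ a', q a'| ≤ ∑ a, (|q a - r| + 1 / N * ∑ a, |q a - r|) := by
        refine Finset.sum_le_sum fun a _ => (abs_sub_le _ r _).trans ?_
        gcongr
    _ = 2 * ∑ a, |q a - r| := by
        rw [Finset.sum_add_distrib, Finset.sum_const, nsmul_eq_mul, Finset.card_univ, hcard]
        field_simp
        ring

/-- A number `p` can be split along any approximation `r₀ + r₁` with `r₁ ≥ 0`, so that the total error of the two parts is that of the approximation. -/
theorem abs_min_sub_add_abs_sub_min {p r₀ r₁ : ℝ} (h₁ : 0 ≤ r₁) :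
    |min r₀ p - r₀| + |p - min r₀ p - r₁| ≤ |p - (r₀ + r₁)| := by
  rcases le_total r₀ p with h | h
  · rw [min_eq_left h, sub_self, abs_zero, zero_add]
    exact le_of_eq (by congr 1; ring)
  · rw [min_eq_right h, sub_self, zero_sub, abs_neg, abs_of_nonneg h₁, abs_of_nonpos (by linarith),
      abs_of_nonpos (by linarith)]
    linarith

/-- The construction of the bit `D` for one measurement outcome: `q false` and `q true` are the
parts of the law `p` of `(A₀, A₁)` on which `D = false` and `D = true`.

With `p ≈ f + g` as in `exists_additive_approx`, the shifted functions `f - min f` and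
`g + min f` are both nonnegative, up to the error on the row where `f` is minimal. On the first part
`A₁` is nearly uniform given `A₀`, and on the second `A₀` is nearly uniform given `A₁`. -/
theorem exists_split {n : ℕ} (p : Bits n → Bits n → ℝ) (hp : ∀ a b, 0 ≤ p a b) {β : ℝ}
    (hβ0 : 0 ≤ β)
    (hβ : ∀ u v : Bits n, u ≠ (fun _ => false) → v ≠ (fun _ => false) → |fourier p u v| ≤ β) :
    ∃ q : Bool → Bits n → Bits n → ℝ, (∀ d a b, 0 ≤ q d a b) ∧
      (∀ a b, ∑ d, q d a b = p a b) ∧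
      (∑ a, ∑ b, |q false b a - 1 / 2 ^ n * ∑ a', q false b a'|)
        + (∑ a, ∑ b, |q true a b - 1 / 2 ^ n * ∑ a', q true a' b|)
        ≤ 4 * (2 ^ n * Real.sqrt (2 ^ n)) * β := by
  obtain ⟨f, g, hfg⟩ := exists_additive_approx p hβ
  set N : ℝ := 2 ^ n with hN
  have hN1 : 1 ≤ N := one_le_pow₀ (by norm_num)
  have hcard : (Fintype.card (Bits n) : ℝ) = N := by simp [hN]
  set e : Bits n → Bits n → ℝ := fun a b => p a b - (f a + g b) with he
  obtain ⟨m, hm⟩ := Finite.exists_min f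
  set r₀ : Bits n → ℝ := fun a => f a - f m
  set r₁ : Bits n → ℝ := fun b => max (g b + f m) 0
  have hr₀ : ∀ a, 0 ≤ r₀ a := fun a => sub_nonneg.2 (hm a)
  have hr₁ : ∀ b, 0 ≤ r₁ b := fun b => le_max_right _ _
  -- The positive part in `r₁` costs at most the error in row `m`, since `p m b ≥ 0`.
  have herr : ∀ a b, |p a b - (r₀ a + r₁ b)| ≤ |e a b| + |e m b| := by
    intro a b
    have h1 : p a b - (r₀ a + r₁ b) = e a b + (g b + f m - r₁ b) := by simp only [he, r₀]; ring
    have h2 : |g b + f m - r₁ b| ≤ |e m b| := by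
      rcases le_total 0 (g b + f m) with h | h
      · simp [r₁, max_eq_left h]
      · have h3 := hp m b
        have h4 : e m b = p m b - (f m + g b) := rfl
        simp only [r₁, max_eq_right h, sub_zero]
        rw [abs_of_nonpos h]
        exact (by linarith : -(g b + f m) ≤ e m b).trans (le_abs_self _)
    rw [h1]
    exact (abs_add_le _ _).trans (by gcongr)
  have hrow : ∑ b, |e m b| ≤ Real.sqrt N * β := by
    have h1 : (∑ b, |e m b|) ^ 2 ≤ N * β ^ 2 := by
      have := sq_sum_le_card_mul_sum_sq (s := (univ : Finset (Bits n))) (f := fun b => |e m b|)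
      rw [Finset.card_univ, hcard] at this
      refine this.trans ?_
      gcongr
      simp only [sq_abs]
      exact (Finset.single_le_sum (f := fun a => ∑ b, e a b ^ 2)
        (fun a _ => Finset.sum_nonneg fun b _ => sq_nonneg _) (mem_univ m)).trans hfg
    rw [← Real.sqrt_sq hβ0, ← Real.sqrt_mul (by positivity)]
    exact Real.le_sqrt_of_sq_le h1
  have hall : ∑ a, ∑ b, |e a b| ≤ N * β := by
    have h1 : (∑ x : Bits n × Bits n, |e x.1 x.2|) ^ 2 ≤ (N * β) ^ 2 := by
      have := sq_sum_le_card_mul_sum_sq (s := (univ : Finset (Bits n × Bits n)))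
        (f := fun x => |e x.1 x.2|)
      rw [Finset.card_univ, Fintype.card_prod, Nat.cast_mul, hcard] at this
      refine this.trans ?_
      rw [mul_pow, ← sq N]
      gcongr
      simp only [sq_abs]
      rw [Fintype.sum_prod_type]
      exact hfg
    rw [← Fintype.sum_prod_type' (f := fun a b => |e a b|)]
    exact (abs_le_of_sq_le_sq' h1 (by positivity)).2
  have htot : ∑ a, ∑ b, |p a b - (r₀ a + r₁ b)| ≤ 2 * (N * Real.sqrt N) * β := by
    calc ∑ a, ∑ b, |p a b - (r₀ a + r₁ b)| ≤ ∑ a, ∑ b, (|e a b| + |e m b|) :=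
          Finset.sum_le_sum fun a _ => Finset.sum_le_sum fun b _ => herr a b
      _ = (∑ a, ∑ b, |e a b|) + N * ∑ b, |e m b| := by
          simp only [Finset.sum_add_distrib, Finset.sum_const, nsmul_eq_mul, Finset.card_univ, hcard]
      _ ≤ N * β + N * (Real.sqrt N * β) := by gcongr
      _ ≤ N * Real.sqrt N * β + N * (Real.sqrt N * β) := by
          gcongr
          exact le_mul_of_one_le_right (by positivity) (Real.one_le_sqrt.2 hN1)
      _ = _ := by ring
  refine ⟨fun d a b => if d then p a b - min (r₀ a) (p a b) else min (r₀ a) (p a b),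
    fun d a b => ?_, fun a b => by simp, ?_⟩
  · cases d
    · simpa using ⟨hr₀ a, hp a b⟩
    · simp
  · simp only [if_true, Bool.false_eq_true, if_false]
    rw [Finset.sum_comm (f := fun a b => |min (r₀ b) (p b a) - _|),
      Finset.sum_comm (f := fun a b => |p a b - min (r₀ a) (p a b) - _|)]
    have h1 := Finset.sum_le_sum fun a (_ : a ∈ univ) =>
      sum_abs_sub_average_le (fun b => min (r₀ a) (p a b)) (r₀ a)
    have h2 := Finset.sum_le_sum fun b (_ : b ∈ univ) =>
      sum_abs_sub_average_le (fun a => p a b - min (r₀ a) (p a b)) (r₁ b)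
    rw [← Finset.mul_sum] at h1 h2
    rw [Finset.sum_comm (f := fun b a => |p a b - min (r₀ a) (p a b) - r₁ b|)] at h2
    have h3 : (∑ a, ∑ b, |min (r₀ a) (p a b) - r₀ a|)
        + (∑ a, ∑ b, |p a b - min (r₀ a) (p a b) - r₁ b|)
        ≤ ∑ a, ∑ b, |p a b - (r₀ a + r₁ b)| := by
      simp only [← Finset.sum_add_distrib]
      exact Finset.sum_le_sum fun a _ => Finset.sum_le_sum fun b _ =>
        abs_min_sub_add_abs_sub_min (hr₁ b)
    linarith

/-! ### Traces and entries of positive operators -/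

theorem trace_conjTranspose_mul_self {ι : Type} [Fintype ι] (K : Matrix ι ι ℂ) :
    (Kᴴ * K).trace = ((∑ i, ∑ j, ‖K i j‖ ^ 2 : ℝ) : ℂ) := by
  simp only [Matrix.trace, Matrix.diag_apply, Matrix.mul_apply, Matrix.conjTranspose_apply]
  rw [Finset.sum_comm]
  push_cast
  exact Finset.sum_congr rfl fun i _ => Finset.sum_congr rfl fun j _ => Complex.conj_mul' _

theorem norm_apply_le_trace {ι : Type} [Fintype ι] {A : Matrix ι ι ℂ}
    (hA : A.PosSemidef) (x y : ι) : ‖A x y‖ ≤ A.trace.re := by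
  obtain ⟨k, v, rfl⟩ := Matrix.posSemidef_iff_eq_sum_vecMulVec.1 hA
  have hv : ∀ i x, ‖v i x‖ ^ 2 ≤ ∑ x, ‖v i x‖ ^ 2 := fun i x =>
    Finset.single_le_sum (f := fun x => ‖v i x‖ ^ 2) (fun _ _ => sq_nonneg _) (mem_univ x)
  have htr : (∑ i, Matrix.vecMulVec (v i) (star (v i))).trace.re = ∑ i, ∑ x, ‖v i x‖ ^ 2 := by
    rw [Matrix.trace_sum, Complex.re_sum]
    refine Finset.sum_congr rfl fun i _ => ?_
    simp only [Matrix.trace, Matrix.diag_apply, Matrix.vecMulVec_apply, Complex.re_sum,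
      Pi.star_apply]
    refine Finset.sum_congr rfl fun x _ => ?_
    rw [RCLike.star_def, Complex.mul_conj']
    norm_cast
  rw [htr, Matrix.sum_apply]
  refine (norm_sum_le _ _).trans (Finset.sum_le_sum fun i _ => ?_)
  rw [Matrix.vecMulVec_apply, norm_mul, Pi.star_apply, norm_star]
  nlinarith [hv i x, hv i y, sq_nonneg (‖v i x‖ - ‖v i y‖)]

theorem trace_conjTranspose_mul_self_mul_nonneg {ι : Type} [Fintype ι] (K : Matrix ι ι ℂ)
    {ρ : Matrix ι ι ℂ} (hρ : ρ.PosSemidef) : 0 ≤ (Kᴴ * K * ρ).trace.re := by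
  rw [Matrix.mul_assoc, Matrix.trace_mul_comm]
  exact (Complex.nonneg_iff.1 (hρ.mul_mul_conjTranspose_same K).trace_nonneg).1

theorem one_sub_posSemidef {ι : Type} [Fintype ι] [DecidableEq ι] (K : Matrix ι ι ℂ)
    (hK : (Kᴴ * K).trace.re ≤ 1) : (1 - Kᴴ * K).PosSemidef := by
  refine Matrix.PosSemidef.of_dotProduct_mulVec_nonneg
    (Matrix.isHermitian_one.sub (Matrix.isHermitian_conjTranspose_mul_self K)) fun x => ?_
  have hstar : ∀ y : ι → ℂ, star y ⬝ᵥ y = ((∑ i, ‖y i‖ ^ 2 : ℝ) : ℂ) := by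
    intro y
    simp only [dotProduct, Pi.star_apply, RCLike.star_def, Complex.conj_mul']
    push_cast
    rfl
  rw [trace_conjTranspose_mul_self, Complex.ofReal_re] at hK
  have h1 : star x ⬝ᵥ (1 - Kᴴ * K) *ᵥ x = ((∑ i, ‖x i‖ ^ 2 - ∑ i, ‖(K *ᵥ x) i‖ ^ 2 : ℝ) : ℂ) := by
    rw [Matrix.sub_mulVec, Matrix.one_mulVec, dotProduct_sub, ← Matrix.mulVec_mulVec,
      Matrix.dotProduct_mulVec, ← Matrix.star_mulVec, hstar, hstar]
    push_cast
    rfl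
  rw [h1, Complex.zero_le_real, sub_nonneg]
  calc ∑ i, ‖(K *ᵥ x) i‖ ^ 2 ≤ ∑ i, (∑ j, ‖K i j‖ ^ 2) * ∑ j, ‖x j‖ ^ 2 := by
        refine Finset.sum_le_sum fun i _ => ?_
        refine le_trans ?_ (Finset.sum_mul_sq_le_sq_mul_sq univ (fun j => ‖K i j‖) fun j => ‖x j‖)
        gcongr
        simp only [Matrix.mulVec, dotProduct, ← norm_mul]
        exact norm_sum_le _ _
    _ ≤ 1 * ∑ j, ‖x j‖ ^ 2 := by
        rw [← Finset.sum_mul]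
        gcongr
    _ = _ := one_mul _

/-! ### Normalized product outcomes and a finite net of them -/

theorem effectOf_eq_tensor {m : ℕ} (K : Fin m → QubitOp) :
    effectOf K = tensor fun j => (K j)ᴴ * K j := by
  rw [effectOf, tensor_conjTranspose, ← tensor_mul]

theorem trace_tensor {m : ℕ} (A : Fin m → QubitOp) : (tensor A).trace = ∏ j, (A j).trace := by
  simp only [Matrix.trace, Matrix.diag_apply, tensor, Matrix.of_apply]
  rw [Finset.prod_univ_sum, Fintype.piFinset_univ]

theorem tensor_smul {m : ℕ} (c : Fin m → ℂ) (A : Fin m → QubitOp) :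
    (tensor fun j => c j • A j) = (∏ j, c j) • tensor A := by
  ext x y
  simp [tensor, Finset.prod_mul_distrib]

/-- Each factor of the product Kraus operator `⊗ K_j` has Hilbert–Schmidt norm `1`. -/
def IsNormalized {m : ℕ} (K : Fin m → QubitOp) : Prop := ∀ j, ((K j)ᴴ * K j).trace = 1

theorem IsNormalized.trace_effectOf {m : ℕ} {K : Fin m → QubitOp} (hK : IsNormalized K) :
    (effectOf K).trace = 1 := by
  rw [effectOf_eq_tensor, trace_tensor]
  exact Finset.prod_eq_one fun j _ => hK j

theorem IsNormalized.isSeparableOutcome {m : ℕ} {K : Fin m → QubitOp} (hK : IsNormalized K) :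
    IsSeparableOutcome (effectOf K) :=
  ⟨⟨K, rfl⟩, one_sub_posSemidef _ (by
    change (effectOf K).trace.re ≤ 1
    rw [hK.trace_effectOf, Complex.one_re])⟩

theorem exists_isNormalized {m : ℕ} (K : Fin m → QubitOp) :
    effectOf K = 0 ∨ ∃ K', IsNormalized K' ∧ 0 < (effectOf K).trace.re ∧
      effectOf K = ((effectOf K).trace.re : ℂ) • effectOf K' := by
  by_cases h0 : ∃ j, K j = 0
  · left
    obtain ⟨j, hj⟩ := h0
    rw [effectOf_eq_tensor]
    ext x y
    simp only [tensor, Matrix.of_apply, Matrix.zero_apply]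
    exact Finset.prod_eq_zero (mem_univ j) (by simp [hj])
  · right
    push Not at h0
    set t : Fin m → ℝ := fun j => ∑ x, ∑ y, ‖K j x y‖ ^ 2
    have ht : ∀ j, ((K j)ᴴ * K j).trace = (t j : ℂ) := fun j => trace_conjTranspose_mul_self _
    have htpos : ∀ j, 0 < t j := by
      intro j
      obtain ⟨x, y, hxy⟩ : ∃ x y, K j x y ≠ 0 := by
        by_contra! h
        exact h0 j (Matrix.ext h)
      refine Finset.sum_pos' (fun _ _ => Finset.sum_nonneg fun _ _ => sq_nonneg _)
        ⟨x, mem_univ x, Finset.sum_pos' (fun _ _ => sq_nonneg _) ⟨y, mem_univ y, ?_⟩⟩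
      have := norm_pos_iff.2 hxy
      positivity
    have htr : (effectOf K).trace = ((∏ j, t j : ℝ) : ℂ) := by
      rw [effectOf_eq_tensor, trace_tensor, Finset.prod_congr rfl fun j _ => ht j]
      push_cast
      rfl
    have hscale : ∀ j, (((1 / Real.sqrt (t j) : ℝ) : ℂ) • K j)ᴴ * (((1 / Real.sqrt (t j) : ℝ) : ℂ) • K j)
        = ((1 / t j : ℝ) : ℂ) • ((K j)ᴴ * K j) := by
      intro j
      rw [Matrix.conjTranspose_smul, Matrix.smul_mul, Matrix.mul_smul, smul_smul, RCLike.star_def,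
        Complex.conj_ofReal, ← Complex.ofReal_mul, div_mul_div_comm, one_mul,
        Real.mul_self_sqrt (htpos j).le]
    refine ⟨fun j => ((1 / Real.sqrt (t j) : ℝ) : ℂ) • K j, fun j => ?_, ?_, ?_⟩
    · rw [hscale, Matrix.trace_smul, ht, smul_eq_mul, ← Complex.ofReal_mul,
        one_div_mul_cancel (htpos j).ne', Complex.ofReal_one]
    · rw [htr, Complex.ofReal_re]
      exact Finset.prod_pos fun j _ => htpos j
    · rw [htr, Complex.ofReal_re, effectOf_eq_tensor fun j => ((1 / Real.sqrt (t j) : ℝ) : ℂ) • K j]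
      simp only [hscale]
      rw [tensor_smul, smul_smul, ← Complex.ofReal_prod, ← Complex.ofReal_mul,
        ← Finset.prod_mul_distrib, Finset.prod_eq_one fun j _ => mul_one_div_cancel (htpos j).ne',
        Complex.ofReal_one, one_smul, effectOf_eq_tensor]

theorem norm_prod_sub_prod_le {ι : Type} (s : Finset ι) (a b : ι → ℂ) (ha : ∀ i, ‖a i‖ ≤ 1)
    (hb : ∀ i, ‖b i‖ ≤ 1) : ‖∏ i ∈ s, a i - ∏ i ∈ s, b i‖ ≤ ∑ i ∈ s, ‖a i - b i‖ := by
  classical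
  induction s using Finset.induction_on with
  | empty => simp
  | insert j s hj ih =>
    rw [Finset.prod_insert hj, Finset.prod_insert hj, Finset.sum_insert hj]
    have h1 : a j * ∏ i ∈ s, a i - b j * ∏ i ∈ s, b i
        = (a j - b j) * ∏ i ∈ s, a i + b j * (∏ i ∈ s, a i - ∏ i ∈ s, b i) := by ring
    have h2 : ‖∏ i ∈ s, a i‖ ≤ 1 := by
      rw [norm_prod]
      exact Finset.prod_le_one (fun _ _ => norm_nonneg _) fun i _ => ha i
    rw [h1]
    refine (norm_add_le _ _).trans ?_
    rw [norm_mul, norm_mul]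
    gcongr
    · exact mul_le_of_le_one_right (norm_nonneg _) h2
    · exact (mul_le_of_le_one_left (norm_nonneg _) (hb j)).trans ih

theorem IsNormalized.norm_factor_le {m : ℕ} {K : Fin m → QubitOp} (hK : IsNormalized K)
    (j : Fin m) (x y : Fin 2) : ‖((K j)ᴴ * K j) x y‖ ≤ 1 := by
  have := norm_apply_le_trace (Matrix.posSemidef_conjTranspose_mul_self (K j)) x y
  rwa [hK j, Complex.one_re] at this

theorem IsNormalized.norm_effectOf_sub_le {m : ℕ} {K K' : Fin m → QubitOp} (hK : IsNormalized K)
    (hK' : IsNormalized K') {c : ℝ}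
    (h : ∀ j x y, ‖((K j)ᴴ * K j) x y - ((K' j)ᴴ * K' j) x y‖ ≤ c) (x y : Fin m → Fin 2) :
    ‖(effectOf K - effectOf K') x y‖ ≤ m * c := by
  rw [effectOf_eq_tensor, effectOf_eq_tensor, Matrix.sub_apply]
  simp only [tensor, Matrix.of_apply]
  refine (norm_prod_sub_prod_le _ _ _ (fun j => hK.norm_factor_le j _ _)
    fun j => hK'.norm_factor_le j _ _).trans ?_
  refine (Finset.sum_le_sum fun j _ => h j (x j) (y j)).trans ?_
  simp

/-- Any set of normalized product operators contains a finite net of itself: round the entries of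
the effects `K_j† K_j` to multiples of `1 / N`, and keep one element of the set for each rounded
value that is attained. Since the representatives are taken from the set itself, they are
non-negligible separable outcomes whenever its elements are. -/
theorem exists_net {m : ℕ} (N : ℕ) (hN : 0 < N) (good : (Fin m → QubitOp) → Prop)
    (hgood : ∀ K, good K → IsNormalized K) :
    ∃ net : Finset (Fin m → QubitOp), #net ≤ (2 * N + 1) ^ (8 * m) ∧ (∀ K ∈ net, good K) ∧
      ∀ K, good K → ∃ K' ∈ net, ∀ j x y,
        ‖((K j)ᴴ * K j) x y - ((K' j)ᴴ * K' j) x y‖ ≤ 2 / N := by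
  classical
  have hN' : (0 : ℝ) < N := by exact_mod_cast hN
  let code : (Fin m → QubitOp) → Fin m → Fin 2 → Fin 2 → ℤ × ℤ := fun K j x y =>
    (⌊(N : ℝ) * (((K j)ᴴ * K j) x y).re⌋, ⌊(N : ℝ) * (((K j)ᴴ * K j) x y).im⌋)
  let S : Finset (Fin m → Fin 2 → Fin 2 → ℤ × ℤ) :=
    Fintype.piFinset fun _ => Fintype.piFinset fun _ => Fintype.piFinset fun _ =>
      Finset.Icc (-(N : ℤ)) N ×ˢ Finset.Icc (-(N : ℤ)) N
  have hfloor : ∀ x : ℝ, |x| ≤ 1 → ⌊(N : ℝ) * x⌋ ∈ Finset.Icc (-(N : ℤ)) N := by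
    intro x hx
    obtain ⟨h1, h2⟩ := abs_le.1 hx
    rw [Finset.mem_Icc, Int.le_floor, Int.floor_le_iff]
    push_cast
    constructor <;> nlinarith
  have hcode : ∀ K, good K → code K ∈ S := by
    intro K hK
    simp only [S, code, Fintype.mem_piFinset, Finset.mem_product]
    intro j x y
    have h := (hgood K hK).norm_factor_le j x y
    exact ⟨hfloor _ ((Complex.abs_re_le_norm _).trans h),
      hfloor _ ((Complex.abs_im_le_norm _).trans h)⟩
  have hclose : ∀ a b : ℝ, ⌊(N : ℝ) * a⌋ = ⌊(N : ℝ) * b⌋ → |a - b| ≤ 1 / N := by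
    intro a b h
    have h1 := Int.abs_sub_lt_one_of_floor_eq_floor h
    rw [← mul_sub, abs_mul, abs_of_pos hN'] at h1
    rw [le_div_iff₀ hN', mul_comm]
    exact h1.le
  let rep : (Fin m → Fin 2 → Fin 2 → ℤ × ℤ) → Fin m → QubitOp := fun c =>
    if h : ∃ K, good K ∧ code K = c then h.choose else 0
  have hrep : ∀ K, good K → good (rep (code K)) ∧ code (rep (code K)) = code K := by
    intro K hK
    have h : ∃ K', good K' ∧ code K' = code K := ⟨K, hK, rfl⟩
    rw [show rep (code K) = h.choose from dif_pos h]
    exact h.choose_spec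
  refine ⟨(S.filter fun c => ∃ K, good K ∧ code K = c).image rep, ?_, ?_, ?_⟩
  · refine Finset.card_image_le.trans ((Finset.card_filter_le _ _).trans (le_of_eq ?_))
    simp only [S, Fintype.card_piFinset_const, Finset.card_product, Int.card_Icc]
    rw [show ((N : ℤ) + 1 - -(N : ℤ)).toNat = 2 * N + 1 by omega]
    rw [← sq, ← pow_mul, ← pow_mul, ← pow_mul]
    congr 1
    ring
  · intro K hK
    obtain ⟨c, hc, rfl⟩ := Finset.mem_image.1 hK
    obtain ⟨K', hK', rfl⟩ := (Finset.mem_filter.1 hc).2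
    exact (hrep K' hK').1
  · intro K hK
    refine ⟨rep (code K), Finset.mem_image_of_mem _ (Finset.mem_filter.2 ⟨hcode K hK, K, hK, rfl⟩),
      fun j x y => ?_⟩
    have h := congrFun (congrFun (congrFun (hrep K hK).2.symm j) x) y
    simp only [code, Prod.mk.injEq] at h
    refine (Complex.norm_le_abs_re_add_abs_im _).trans ?_
    rw [Complex.sub_re, Complex.sub_im, show (2 : ℝ) / N = 1 / N + 1 / N by ring]
    exact add_le_add (hclose _ _ h.1) (hclose _ _ h.2)

/-! ### Expectations of Alice's outputs on a measurement outcome -/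

namespace ROTProtocol

variable {m n : ℕ}

/-- The expectation of `φ (A₀, A₁)` on the event that a measurement yields the outcome with effect
`M` (not divided by the probability of that event). -/
def outcomeMean (P : ROTProtocol m n) (φ : Bits n → Bits n → ℝ) (M : Op m) : ℝ :=
  ∑ ω, P.prob ω * (M * P.state ω).trace.re * φ (P.out false ω) (P.out true ω)

theorem outcomeMean_eq_sum_jointProb (P : ROTProtocol m n) (φ : Bits n → Bits n → ℝ) (M : Op m) :
    P.outcomeMean φ M = ∑ s, ∑ t, P.jointProb M s t * φ s t := by
  have h : ∀ ω, P.prob ω * (M * P.state ω).trace.re * φ (P.out false ω) (P.out true ω)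
      = ∑ s, ∑ t, (if P.out false ω = s ∧ P.out true ω = t
          then P.prob ω * (M * P.state ω).trace.re else 0) * φ s t := by
    intro ω
    rw [Finset.sum_eq_single (P.out false ω)
      (fun s _ hs => Finset.sum_eq_zero fun t _ => by simp [hs.symm]) (by simp),
      Finset.sum_eq_single (P.out true ω) (fun t _ ht => by simp [ht.symm]) (by simp)]
    simp
  rw [outcomeMean, Finset.sum_congr rfl fun ω _ => h ω, Finset.sum_comm]
  refine Finset.sum_congr rfl fun s _ => ?_
  rw [Finset.sum_comm]
  refine Finset.sum_congr rfl fun t _ => ?_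
  rw [jointProb, Finset.sum_mul]

theorem trace_mul_avgState (P : ROTProtocol m n) (M : Op m) :
    (M * P.avgState).trace.re = ∑ ω, P.prob ω * (M * P.state ω).trace.re := by
  simp [avgState, Finset.mul_sum, Matrix.trace_sum, Complex.re_sum]

theorem fourier_jointProb_hash {n' : ℕ} (P : ROTProtocol m n) (F G : Bits n → Bits n') (M : Op m)
    (u v : Bits n') :
    fourier ((P.hash F G).jointProb M) u v
      = P.outcomeMean (fun s t => walsh u (F s) * walsh v (G t)) M := by
  rw [fourier, ← outcomeMean_eq_sum_jointProb (P.hash F G) fun a b => walsh u a * walsh v b]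
  simp only [outcomeMean, hash, Bool.false_eq_true, if_false, if_true]
  rfl

theorem outcomeMean_smul (P : ROTProtocol m n) (φ : Bits n → Bits n → ℝ) (c : ℝ) (M : Op m) :
    P.outcomeMean φ ((c : ℂ) • M) = c * P.outcomeMean φ M := by
  simp only [outcomeMean, Matrix.smul_mul, Matrix.trace_smul, smul_eq_mul, Complex.re_ofReal_mul]
  rw [Finset.mul_sum]
  exact Finset.sum_congr rfl fun ω _ => by ring

theorem outcomeMean_sub (P : ROTProtocol m n) (φ : Bits n → Bits n → ℝ) (M M' : Op m) :
    P.outcomeMean φ (M - M') = P.outcomeMean φ M - P.outcomeMean φ M' := by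
  simp only [outcomeMean, Matrix.sub_mul, Matrix.trace_sub, Complex.sub_re]
  rw [← Finset.sum_sub_distrib]
  exact Finset.sum_congr rfl fun ω _ => by ring

theorem trace_effectOf_mul_state_nonneg (P : ROTProtocol m n) (K : Fin m → QubitOp) (ω : P.Coins) :
    0 ≤ (effectOf K * P.state ω).trace.re :=
  trace_conjTranspose_mul_self_mul_nonneg _ (P.state_posSemidef ω)

theorem jointProb_effectOf_nonneg (P : ROTProtocol m n) (K : Fin m → QubitOp) (s t : Bits n) :
    0 ≤ P.jointProb (effectOf K) s t :=
  Finset.sum_nonneg fun ω _ => by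
    split_ifs
    · exact mul_nonneg (P.prob_nonneg ω) (P.trace_effectOf_mul_state_nonneg K ω)
    · exact le_rfl

theorem abs_outcomeMean_effectOf_le (P : ROTProtocol m n) {φ : Bits n → Bits n → ℝ}
    (hφ : ∀ s t, |φ s t| ≤ 1) (K : Fin m → QubitOp) :
    |P.outcomeMean φ (effectOf K)| ≤ (effectOf K * P.avgState).trace.re := by
  rw [trace_mul_avgState]
  refine (Finset.abs_sum_le_sum_abs _ _).trans (Finset.sum_le_sum fun ω _ => ?_)
  have h := mul_nonneg (P.prob_nonneg ω) (P.trace_effectOf_mul_state_nonneg K ω)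
  rw [abs_mul, abs_of_nonneg h]
  exact mul_le_of_le_one_right h (hφ _ _)

/-- The dependence of `outcomeMean` on the entries of the effect. The dimension factor is harmless,
because the net can be taken exponentially fine in the number of qubits. -/
theorem abs_outcomeMean_le_of_entries (P : ROTProtocol m n) {φ : Bits n → Bits n → ℝ}
    (hφ : ∀ s t, |φ s t| ≤ 1) (A : Op m) {c : ℝ} (hA : ∀ x y, ‖A x y‖ ≤ c) :
    |P.outcomeMean φ A| ≤ 4 ^ m * c := by
  have h1 : ∀ ω, |(A * P.state ω).trace.re| ≤ 4 ^ m * c := by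
    intro ω
    refine (Complex.abs_re_le_norm _).trans ?_
    simp only [Matrix.trace, Matrix.diag_apply, Matrix.mul_apply]
    calc ‖∑ x, ∑ y, A x y * P.state ω y x‖ ≤ ∑ x : Fin m → Fin 2, ∑ y : Fin m → Fin 2, c * 1 := by
          refine (norm_sum_le _ _).trans (Finset.sum_le_sum fun x _ => (norm_sum_le _ _).trans
            (Finset.sum_le_sum fun y _ => ?_))
          rw [norm_mul]
          have h2 := norm_apply_le_trace (P.state_posSemidef ω) y x
          rw [P.state_trace, Complex.one_re] at h2
          exact mul_le_mul (hA x y) h2 (norm_nonneg _) ((norm_nonneg _).trans (hA x y))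
      _ = 4 ^ m * c := by
          simp only [Finset.sum_const, nsmul_eq_mul, Finset.card_univ, Fintype.card_fun,
            Fintype.card_fin]
          push_cast
          rw [mul_one, ← mul_assoc, ← mul_pow]
          norm_num
  calc |P.outcomeMean φ A| ≤ ∑ ω, P.prob ω * (4 ^ m * c) := by
        refine (Finset.abs_sum_le_sum_abs _ _).trans (Finset.sum_le_sum fun ω _ => ?_)
        rw [abs_mul, abs_mul, abs_of_nonneg (P.prob_nonneg ω)]
        have h2 := mul_nonneg (P.prob_nonneg ω) (abs_nonneg (A * P.state ω).trace.re)
        exact (mul_le_of_le_one_right h2 (hφ _ _)).trans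
          (mul_le_mul_of_nonneg_left (h1 ω) (P.prob_nonneg ω))
    _ = 4 ^ m * c := by rw [← Finset.sum_mul, P.prob_sum, one_mul]

theorem trace_avgState (P : ROTProtocol m n) : P.avgState.trace.re = 1 := by
  have := P.trace_mul_avgState 1
  simpa [P.state_trace, P.prob_sum] using this

end ROTProtocol

/-! ### Concentration for a fixed measurement outcome -/

theorem exists_of_le_smoothMinEntropy {X : Type} [Fintype X] {ε h : ℝ} {p : X → ℝ}
    (hp : (h : EReal) ≤ smoothMinEntropy ε p) :
    ∃ q : X → ℝ, (∀ x, 0 ≤ q x ∧ q x ≤ p x) ∧ 1 - ε ≤ ∑ x, q x ∧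
      ∀ x, q x ≤ 2 * (2 : ℝ) ^ (-h) := by
  -- The supremum need not be attained, which costs one bit.
  have h1 : ((h - 1 : ℝ) : EReal) < smoothMinEntropy ε p :=
    lt_of_lt_of_le (by exact_mod_cast sub_one_lt h) hp
  rw [smoothMinEntropy, lt_iSup_iff] at h1
  obtain ⟨q, h1⟩ := h1
  rw [lt_iSup_iff] at h1
  obtain ⟨⟨hq, hsum⟩, h1⟩ := h1
  refine ⟨q, hq, hsum, fun x => ?_⟩
  have h2 := h1.trans_le (iInf_le _ x)
  rcases (hq x).1.eq_or_lt with h0 | hpos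
  · rw [← h0]; positivity
  · rw [negLog2, if_neg hpos.ne', EReal.coe_lt_coe_iff] at h2
    have h3 : Real.logb 2 (q x) < 1 + -h := by linarith
    rw [Real.logb_lt_iff_lt_rpow (by norm_num) hpos, Real.rpow_add (by norm_num), Real.rpow_one] at h3
    exact h3.le

theorem moment_div_pow_le {x W : ℝ} (hx : 0 < x) (hW0 : 0 ≤ W) (hW : W ≤ 2 * x ^ 2) {p : ℕ}
    (hp : 2 ≤ p) :
    (4 * ((2 * p).factorial : ℝ)) ^ 2 * W ^ p / (8 * (2 * p : ℕ) ^ 2 * x) ^ (2 * p)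
      ≤ (1 / 2) ^ (2 * p) := by
  have hp0 : (0 : ℝ) < (2 * p : ℕ) := by exact_mod_cast (by omega : 0 < 2 * p)
  set P : ℝ := ((2 * p : ℕ) : ℝ) with hP
  rw [div_le_iff₀ (by positivity)]
  have hfac : ((2 * p).factorial : ℝ) ≤ P ^ (2 * p) := by
    rw [hP]; exact_mod_cast Nat.factorial_le_pow (2 * p)
  have h8 : (16 : ℝ) ≤ 8 ^ p :=
    le_trans (by norm_num : (16 : ℝ) ≤ 8 ^ 2) (pow_le_pow_right₀ (by norm_num) hp)
  calc (4 * ((2 * p).factorial : ℝ)) ^ 2 * W ^ p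
      ≤ (4 * P ^ (2 * p)) ^ 2 * (2 * x ^ 2) ^ p := by gcongr
    _ = 16 * (2 ^ p * (P ^ 2) ^ (2 * p) * x ^ (2 * p)) := by
        rw [mul_pow 4, mul_pow 2, ← pow_mul, ← pow_mul, ← pow_mul, mul_comm (2 * p) 2]
        ring
    _ ≤ 8 ^ p * (2 ^ p * (P ^ 2) ^ (2 * p) * x ^ (2 * p)) := by gcongr
    _ = (1 / 2) ^ (2 * p) * (8 * P ^ 2 * x) ^ (2 * p) := by
        rw [mul_pow, mul_pow 8, ← mul_assoc, ← mul_assoc, ← mul_assoc, ← mul_assoc, ← mul_pow,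
          ← mul_pow, pow_mul (1 / 2 * 8 : ℝ)]
        norm_num

namespace ROTProtocol

variable {m l n : ℕ}

/-- For a fixed outcome, given which Alice's strings have smooth min-entropy, the characters of the
hashed strings are nearly unbiased except with tiny probability over the hash functions. The number
`x ^ 2` stands for `2 ^ (-h)`, where `h` is the min-entropy. -/
theorem unifProb_bias_le (P : ROTProtocol m l) (K : Fin m → QubitOp)
    (hM : 0 < (effectOf K * P.avgState).trace.re) {ε x : ℝ} (hx : 0 < x)
    {q : Bits l × Bits l → ℝ} (hq : ∀ a, 0 ≤ q a ∧ q a ≤ P.condLaw (effectOf K) a)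
    (hqsum : 1 - ε ≤ ∑ a, q a) (hqx : ∀ a, q a ≤ 2 * x ^ 2) {r p : ℕ} (hp : 2 ≤ p)
    (hpr : 2 * p ≤ r) {I J : Type} [Fintype I] [Fintype J] {F : I → Bits l → Bits n}
    {G : J → Bits l → Bits n} (hF : WiseIndependent r F) (hG : WiseIndependent r G)
    {u v : Bits n} (hu : u ≠ fun _ => false) (hv : v ≠ fun _ => false) :
    unifProb {f : I × J | (8 * (2 * p : ℕ) ^ 2 * x + ε) * (effectOf K * P.avgState).trace.re
        < |P.outcomeMean (fun s t => walsh u (F f.1 s) * walsh v (G f.2 t)) (effectOf K)|}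
      ≤ (1 / 2) ^ (2 * p) := by
  set w := (effectOf K * P.avgState).trace.re with hw
  have hp0 : (0 : ℝ) < (2 * p : ℕ) := by exact_mod_cast (by omega : 0 < 2 * p)
  have hsum : ∑ a, P.condLaw (effectOf K) a = 1 := by
    have h1 : P.outcomeMean (fun _ _ => 1) (effectOf K) = w := by
      rw [hw, trace_mul_avgState]
      simp [outcomeMean]
    rw [outcomeMean_eq_sum_jointProb] at h1
    simp only [mul_one] at h1
    rw [Fintype.sum_prod_type]
    simp only [condLaw]
    simp only [← Finset.sum_div]
    rw [h1, ← hw, div_self hM.ne']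
  have hqle : ∑ a, q a ≤ 1 := hsum ▸ Finset.sum_le_sum fun a _ => (hq a).2
  have hsub : {f : I × J | (8 * (2 * p : ℕ) ^ 2 * x + ε) * w
        < |P.outcomeMean (fun s t => walsh u (F f.1 s) * walsh v (G f.2 t)) (effectOf K)|}
      ⊆ {f : I × J | 8 * (2 * p : ℕ) ^ 2 * x
        < |∑ s, ∑ t, q (s, t) * (walsh u (F f.1 s) * walsh v (G f.2 t))|} := by
    intro f hf
    simp only [Set.mem_ofPred_eq] at hf ⊢
    set φ : Bits l × Bits l → ℝ := fun a => walsh u (F f.1 a.1) * walsh v (G f.2 a.2) with hφ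
    have hφ1 : ∀ a, |φ a| = 1 := fun a => by rw [hφ, abs_mul, abs_walsh, abs_walsh, one_mul]
    have h1 : P.outcomeMean (fun s t => walsh u (F f.1 s) * walsh v (G f.2 t)) (effectOf K)
        = w * (∑ a, q a * φ a + ∑ a, (P.condLaw (effectOf K) a - q a) * φ a) := by
      rw [outcomeMean_eq_sum_jointProb, ← Finset.sum_add_distrib, Finset.mul_sum,
        Fintype.sum_prod_type]
      refine Finset.sum_congr rfl fun s _ => Finset.sum_congr rfl fun t _ => ?_
      simp only [condLaw, hφ, ← hw]
      field_simp
      ring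
    have h2 : |∑ a, (P.condLaw (effectOf K) a - q a) * φ a| ≤ ε := by
      refine (Finset.abs_sum_le_sum_abs _ _).trans ?_
      simp only [abs_mul, hφ1, mul_one]
      rw [Finset.sum_congr rfl fun a _ => abs_of_nonneg (sub_nonneg.2 (hq a).2),
        Finset.sum_sub_distrib]
      linarith
    rw [h1, abs_mul, abs_of_pos hM, mul_comm, mul_lt_mul_iff_right₀ hM] at hf
    have h3 := hf.trans_le (abs_add_le _ _)
    rw [Fintype.sum_prod_type] at h3
    linarith
  refine (unifProb_mono hsub).trans
    ((unifProb_lt_abs_le _ (by positivity : 0 < 8 * ((2 * p : ℕ) : ℝ) ^ 2 * x) p).trans ?_)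
  refine le_trans (div_le_div_of_nonneg_right (hF.chaos_moment_le hG (expect_exp_walsh_le hu)
    (expect_exp_walsh_le hv) (fun s t => q (s, t)) (by omega) hpr) (by positivity)) ?_
  refine moment_div_pow_le hx (by positivity) ?_ hp
  calc ∑ s, ∑ t, q (s, t) ^ 2 = ∑ a, q a ^ 2 := by rw [Fintype.sum_prod_type]
    _ ≤ ∑ a, 2 * x ^ 2 * q a := by
        refine Finset.sum_le_sum fun a _ => ?_
        rw [sq]
        exact mul_le_mul_of_nonneg_right (hqx a) (hq a).1
    _ ≤ 2 * x ^ 2 * 1 := by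
        rw [← Finset.mul_sum]
        gcongr
    _ = _ := mul_one _

/-! ### From the net to all separable measurements -/

theorem trace_effectOf_mul_pos {δ : ℝ} (hδ : 0 < δ) {ρ : Op m} {K : Fin m → QubitOp}
    (hK : IsNormalized K) (h : NonNegligible δ ρ (effectOf K)) : 0 < (effectOf K * ρ).trace.re := by
  refine lt_of_lt_of_le ?_ h
  rw [hK.trace_effectOf, Complex.one_re]
  positivity

/-- The bound for one outcome passes to every outcome whose effects are entrywise close to it. -/
theorem abs_outcomeMean_le_of_close (P : ROTProtocol m n) {φ : Bits n → Bits n → ℝ}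
    (hφ : ∀ s t, |φ s t| ≤ 1) {K K' : Fin m → QubitOp} (hK : IsNormalized K)
    (hK' : IsNormalized K') {c b : ℝ} (hb : 0 ≤ b)
    (hc : ∀ j x y, ‖((K j)ᴴ * K j) x y - ((K' j)ᴴ * K' j) x y‖ ≤ c)
    (h : |P.outcomeMean φ (effectOf K')| ≤ b * (effectOf K' * P.avgState).trace.re) :
    |P.outcomeMean φ (effectOf K)|
      ≤ b * (effectOf K * P.avgState).trace.re + 2 * (4 ^ m * (m * c)) := by
  have hent := hK.norm_effectOf_sub_le hK' hc
  have hc0 : 0 ≤ 4 ^ m * (m * c) := by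
    have := (norm_nonneg _).trans (hent 0 0)
    positivity
  have hw : 0 ≤ (effectOf K * P.avgState).trace.re :=
    (abs_nonneg _).trans (P.abs_outcomeMean_effectOf_le hφ K)
  rcases le_total 1 b with h1 | h1
  · have := P.abs_outcomeMean_effectOf_le hφ K
    nlinarith
  · have e1 := P.abs_outcomeMean_le_of_entries hφ _ hent
    have e2 := P.abs_outcomeMean_le_of_entries (φ := fun _ _ => 1) (by simp) _ hent
    have e3 : ∀ M, P.outcomeMean (fun _ _ => 1) M = (M * P.avgState).trace.re := fun M => by
      rw [trace_mul_avgState]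
      simp [outcomeMean]
    rw [outcomeMean_sub] at e1 e2
    rw [e3, e3] at e2
    have e4 := abs_sub_abs_le_abs_sub (P.outcomeMean φ (effectOf K)) (P.outcomeMean φ (effectOf K'))
    have e5 := (abs_le.1 e2).1
    nlinarith

/-- If every normalized non-negligible outcome leaves the characters of the hashed strings nearly
unbiased, then the hashed protocol is secure. Negligible outcomes contribute at most `δ` in total,
since the traces of the effects sum to `2 ^ m`. -/
theorem secureForAlice_of_bias_le (P : ROTProtocol m l) (F G : Bits l → Bits n) {δ b Δ : ℝ}
    (hδ : 0 ≤ δ) (hb : 0 ≤ b) (hΔ : 0 ≤ Δ)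
    (h : ∀ K, IsNormalized K → NonNegligible δ P.avgState (effectOf K) →
      ∀ u v : Bits n, u ≠ (fun _ => false) → v ≠ (fun _ => false) →
        |P.outcomeMean (fun s t => walsh u (F s) * walsh v (G t)) (effectOf K)|
          ≤ b * (effectOf K * P.avgState).trace.re + Δ) :
    (P.hash F G).SecureForAlice (4 * (2 ^ n * Real.sqrt (2 ^ n)) * (b + 2 ^ m * Δ + δ)) := by
  intro B
  set β : B.Outcome → ℝ := fun z => b * (B.effect z * P.avgState).trace.re
    + (Δ + δ / 2 ^ m) * (B.effect z).trace.re with hβdef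
  have hw : ∀ K : Fin m → QubitOp, 0 ≤ (effectOf K * P.avgState).trace.re := fun K => by
    rw [trace_mul_avgState]
    exact Finset.sum_nonneg fun ω _ =>
      mul_nonneg (P.prob_nonneg ω) (P.trace_effectOf_mul_state_nonneg K ω)
  have htr : ∀ K : Fin m → QubitOp, 0 ≤ (effectOf K).trace.re := fun K =>
    (Complex.nonneg_iff.1 (Matrix.posSemidef_conjTranspose_mul_self (tensor K)).trace_nonneg).1
  have hβ0 : ∀ z, 0 ≤ β z := fun z => by
    have h1 : 0 ≤ (B.effect z * P.avgState).trace.re := hw _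
    have h2 : 0 ≤ (B.effect z).trace.re := htr _
    positivity
  have hβ : ∀ z (u v : Bits n), u ≠ (fun _ => false) → v ≠ (fun _ => false) →
      |fourier ((P.hash F G).jointProb (B.effect z)) u v| ≤ β z := by
    intro z u v hu hv
    rw [fourier_jointProb_hash]
    simp only [hβdef, SeparableMeasurement.effect]
    have hφ : ∀ s t, |walsh u (F s) * walsh v (G t)| ≤ 1 := fun s t => by
      rw [abs_mul, abs_walsh, abs_walsh, one_mul]
    rcases exists_isNormalized (B.kraus z) with h0 | ⟨K, hK, htpos, heq⟩
    · rw [h0]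
      simp [outcomeMean]
    · set t := (effectOf (B.kraus z)).trace.re
      rw [heq, outcomeMean_smul, abs_mul, abs_of_pos htpos, Matrix.smul_mul, Matrix.trace_smul,
        smul_eq_mul, Complex.re_ofReal_mul]
      rw [← mul_assoc, mul_comm b, mul_assoc, mul_comm (Δ + _) t, ← mul_add]
      refine mul_le_mul_of_nonneg_left ?_ htpos.le
      by_cases hneg : NonNegligible δ P.avgState (effectOf K)
      · refine (h K hK hneg u v hu hv).trans ?_
        have : 0 ≤ δ / 2 ^ m := by positivity
        linarith
      · rw [NonNegligible, hK.trace_effectOf, Complex.one_re, mul_one, not_le] at hneg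
        refine (P.abs_outcomeMean_effectOf_le hφ K).trans (hneg.le.trans ?_)
        have := mul_nonneg hb (hw K)
        linarith
  have hsplit := fun z => exists_split ((P.hash F G).jointProb (B.effect z))
    (fun a₀ a₁ => (P.hash F G).jointProb_effectOf_nonneg (B.kraus z) a₀ a₁) (hβ0 z) (hβ z)
  choose q hq0 hqsum hqdist using hsplit
  refine ⟨fun d a₀ a₁ z => q z d a₀ a₁, ⟨fun d a₀ a₁ z => hq0 z d a₀ a₁,
    fun a₀ a₁ z => hqsum z a₀ a₁⟩, ?_⟩
  have hdist : distFromOblivious (fun d a₀ a₁ z => q z d a₀ a₁)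
      = ∑ z, ((∑ a, ∑ b, |q z false b a - 1 / 2 ^ n * ∑ a', q z false b a'|)
        + (∑ a, ∑ b, |q z true a b - 1 / 2 ^ n * ∑ a', q z true a' b|)) := by
    simp only [distFromOblivious, reordered, Fintype.sum_bool, Bool.false_eq_true, if_true, if_false,
      ← Finset.sum_add_distrib]
    simp only [fun a => Finset.sum_comm (s := (univ : Finset (Bits n)))
      (t := (univ : Finset B.Outcome)) (f := fun b z =>
        |q z true a b - 1 / 2 ^ n * ∑ a', q z true a' b|
          + |q z false b a - 1 / 2 ^ n * ∑ a', q z false b a'|)]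
    rw [Finset.sum_comm]
    refine Finset.sum_congr rfl fun z _ => Finset.sum_congr rfl fun a _ =>
      Finset.sum_congr rfl fun b _ => add_comm _ _
  have hcomp : ∑ z, B.effect z = 1 := B.complete
  have hsum1 : ∑ z, (B.effect z * P.avgState).trace.re = 1 := by
    rw [← Complex.re_sum, ← Matrix.trace_sum, ← Finset.sum_mul, hcomp, one_mul, P.trace_avgState]
  have hsum2 : ∑ z, (B.effect z).trace.re = 2 ^ m := by
    rw [← Complex.re_sum, ← Matrix.trace_sum, hcomp, Matrix.trace_one]
    simp
    norm_cast
  rw [hdist]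
  refine (Finset.sum_le_sum fun z _ => hqdist z).trans (le_of_eq ?_)
  rw [← Finset.mul_sum]
  simp only [hβdef]
  rw [Finset.sum_add_distrib, ← Finset.mul_sum, ← Finset.mul_sum, hsum1, hsum2]
  field_simp
  ring

theorem SecureForAlice.mono {P : ROTProtocol m n} {e e' : ℝ} (h : P.SecureForAlice e)
    (he : e ≤ e') : P.SecureForAlice e' := fun B => by
  obtain ⟨Q, h1, h2⟩ := h B
  exact ⟨Q, h1, h2.trans he⟩

theorem Correct.hash {P : ROTProtocol m l} {η : ℝ} (h : P.Correct η) (F G : Bits l → Bits n) :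
    (P.hash F G).Correct η := by
  intro d
  refine (h d).trans ?_
  change _ ≤ ∑ ω : P.Coins, ∑ z : (P.bob d).Outcome,
    if (P.hash F G).decode d z = (P.hash F G).out d ω
      then P.prob ω * ((P.bob d).toSeparable.effect z * P.state ω).trace.re else 0
  refine Finset.sum_le_sum fun ω _ => Finset.sum_le_sum fun z _ => ?_
  have h0 : 0 ≤ P.prob ω * ((P.bob d).toSeparable.effect z * P.state ω).trace.re :=
    mul_nonneg (P.prob_nonneg ω) (P.trace_effectOf_mul_state_nonneg _ ω)
  by_cases hz : P.decode d z = P.out d ω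
  · have : (P.hash F G).decode d z = (P.hash F G).out d ω := by
      cases d <;> simp [ROTProtocol.hash, hz]
    rw [if_pos hz, if_pos this]
  · rw [if_neg hz]
    split_ifs
    · exact h0
    · exact le_rfl

/-- Except with small probability over the hash functions, the hashed protocol is secure. The three
factors of the probability are the size of the net, the number of pairs of characters, and the
failure probability for one outcome and one pair. -/
theorem unifProb_not_secure_le (P : ROTProtocol m l) {δ ε x : ℝ} (hδ : 0 < δ) (hε : 0 ≤ ε)
    (hx : 0 < x)
    (hP : ∀ K : Fin m → QubitOp, IsNormalized K → NonNegligible δ P.avgState (effectOf K) →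
      ∃ q : Bits l × Bits l → ℝ, (∀ a, 0 ≤ q a ∧ q a ≤ P.condLaw (effectOf K) a) ∧
        1 - ε ≤ ∑ a, q a ∧ ∀ a, q a ≤ 2 * x ^ 2)
    {r p : ℕ} (hp : 2 ≤ p) (hpr : 2 * p ≤ r) {I J : Type} [Fintype I] [Fintype J]
    {F : I → Bits l → Bits n} {G : J → Bits l → Bits n} (hF : WiseIndependent r F)
    (hG : WiseIndependent r G) {N : ℕ} (hN : 0 < N) :
    unifProb {f : I × J | ¬ (P.hash (F f.1) (G f.2)).SecureForAlice
        (4 * (2 ^ n * Real.sqrt (2 ^ n)) *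
          (8 * (2 * p : ℕ) ^ 2 * x + ε + 2 ^ m * (2 * (4 ^ m * (m * (2 / N)))) + δ))}
      ≤ (2 * N + 1 : ℕ) ^ (8 * m) * (2 ^ n) ^ 2 * (1 / 2) ^ (2 * p) := by
  classical
  obtain ⟨net, hcard, hgood, hnet⟩ := exists_net N hN
    (fun K => IsNormalized K ∧ NonNegligible δ P.avgState (effectOf K)) fun K hK => hK.1
  set b : ℝ := 8 * (2 * p : ℕ) ^ 2 * x + ε with hbdef
  have hb : 0 ≤ b := by positivity
  let E : net × Bits n × Bits n → Set (I × J) := fun c => {f |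
    (c.2.1 ≠ (fun _ => false) ∧ c.2.2 ≠ (fun _ => false)) ∧
    b * (effectOf c.1.1 * P.avgState).trace.re <
      |P.outcomeMean (fun s t => walsh c.2.1 (F f.1 s) * walsh c.2.2 (G f.2 t)) (effectOf c.1.1)|}
  have hsub : {f : I × J | ¬ (P.hash (F f.1) (G f.2)).SecureForAlice
      (4 * (2 ^ n * Real.sqrt (2 ^ n)) *
        (b + 2 ^ m * (2 * (4 ^ m * (m * (2 / N)))) + δ))} ⊆ ⋃ c, E c := by
    intro f hf
    by_contra hnot
    simp only [Set.mem_iUnion, not_exists] at hnot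
    refine hf (P.secureForAlice_of_bias_le (F f.1) (G f.2) hδ.le hb (by positivity) ?_)
    intro K hK hneg u v hu hv
    obtain ⟨K', hK', hclose⟩ := hnet K ⟨hK, hneg⟩
    refine P.abs_outcomeMean_le_of_close (fun s t => ?_) hK (hgood K' hK').1 hb hclose ?_
    · rw [abs_mul, abs_walsh, abs_walsh, one_mul]
    · by_contra hlt
      exact hnot (⟨K', hK'⟩, u, v) ⟨⟨hu, hv⟩, not_le.1 hlt⟩
  have hE : ∀ c, unifProb (E c) ≤ (1 / 2) ^ (2 * p) := by
    rintro ⟨⟨K, hK⟩, u, v⟩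
    by_cases huv : u ≠ (fun _ => false) ∧ v ≠ (fun _ => false)
    · obtain ⟨hK1, hK2⟩ := hgood K hK
      obtain ⟨q, hq, hqs, hqx⟩ := hP K hK1 hK2
      refine le_trans (unifProb_mono ?_) (P.unifProb_bias_le K (trace_effectOf_mul_pos hδ hK1 hK2)
        hx hq hqs hqx hp hpr hF hG huv.1 huv.2)
      exact fun f hf => hf.2
    · have : E (⟨K, hK⟩, u, v) = ∅ := by
        ext f
        simp only [E, Set.mem_ofPred_eq, Set.mem_empty_iff_false, iff_false]
        exact fun h => huv h.1
      rw [this, unifProb, Set.ncard_empty]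
      simp
  refine (unifProb_mono hsub).trans ((unifProb_iUnion_le E).trans
    ((Finset.sum_le_sum fun c _ => hE c).trans ?_))
  rw [Finset.sum_const, nsmul_eq_mul, Finset.card_univ]
  gcongr
  simp only [Fintype.card_prod, Fintype.card_coe, Fintype.card_fun, Fintype.card_bool,
    Fintype.card_fin]
  rw [← sq]
  push_cast
  gcongr
  exact_mod_cast hcard

end ROTProtocol

/-! ### The choice of constants -/

theorem eventually_mul_rpow_le (C s : ℝ) {b : ℝ} (hb : 0 < b) :
    ∀ᶠ k : ℕ in Filter.atTop, C * (k : ℝ) ^ s ≤ (2 : ℝ) ^ (b * k) := by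
  have hb' : 0 < Real.log 2 * b := mul_pos (Real.log_pos (by norm_num)) hb
  have h1 : (fun x : ℝ => C * x ^ s) =o[Filter.atTop] fun x => Real.exp (Real.log 2 * b * x) :=
    (isLittleO_rpow_exp_pos_mul_atTop s hb').const_mul_left C
  filter_upwards [tendsto_natCast_atTop_atTop.eventually (h1.bound one_pos)] with k hk
  rw [one_mul, Real.norm_of_nonneg (Real.exp_pos _).le, mul_assoc] at hk
  rw [Real.rpow_def_of_pos (by norm_num : (0 : ℝ) < 2)]
  exact (le_abs_self _).trans hk

theorem two_rpow_two_mul_natCast_add_one (n : ℕ) :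
    (2 : ℝ) ^ (2 * ((n : ℝ) + 1)) = 4 * (2 ^ n) ^ 2 := by
  rw [mul_add, Real.rpow_add (by norm_num), ← pow_mul, mul_comm n 2, mul_one,
    ← Real.rpow_natCast 2 (2 * n)]
  push_cast
  norm_num
  ring

/-- The error that the proof incurs is within the explicit bound, as soon as `2 ^ (l' / 2)` exceeds
the (polynomial) losses; the last term of the bound is not needed. The constant `32 = 4 * 8` comes
from the factor `1 / 8` in the term for `ε`. -/
theorem error_le_errorBound {θ δ₀ α ε₀ γ ε : ℝ} {k l' : ℕ} {R : ℝ}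
    (hε : ε ≤ (2 : ℝ) ^ (-(ε₀ * k))) (h32 : 32 ≤ Real.sqrt (2 ^ l'))
    (hsqrt : R ≤ Real.sqrt (2 ^ l')) :
    4 * (2 ^ l' * Real.sqrt (2 ^ l')) *
        (R * (2 : ℝ) ^ (-(α / 2 * k)) + ε + (2 : ℝ) ^ (-(δ₀ * k)))
      ≤ errorBound θ δ₀ α ε₀ γ k l' := by
  set s := Real.sqrt (2 ^ l') with hs
  have hs2 : (2 : ℝ) ^ l' = s ^ 2 := (Real.sq_sqrt (by positivity)).symm
  have hs0 : 0 < s := by linarith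
  set x := (2 : ℝ) ^ (-(α / 2 * k)) with hx
  set d := (2 : ℝ) ^ (-(δ₀ * k)) with hd
  set e := (2 : ℝ) ^ (-(ε₀ * k)) with he
  have hx0 : 0 < x := by positivity
  have hd0 : 0 < d := by positivity
  have he0 : 0 < e := by positivity
  have h1 : (2 : ℝ) ^ (-(δ₀ * k - 2 * ((l' : ℝ) + 1))) = 4 * s ^ 4 * d := by
    rw [show -(δ₀ * k - 2 * ((l' : ℝ) + 1)) = 2 * ((l' : ℝ) + 1) + -(δ₀ * k) by ring,
      Real.rpow_add (by norm_num), two_rpow_two_mul_natCast_add_one, hs2]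
    ring
  have h2 : (2 : ℝ) ^ (-(ε₀ * k - 2 * (l' : ℝ) + 3)) = s ^ 4 * e / 8 := by
    rw [show -(ε₀ * k - 2 * (l' : ℝ) + 3) = 2 * ((l' : ℝ) + 1) + -(ε₀ * k) + (-5 : ℤ) by
      push_cast; ring, Real.rpow_add (by norm_num), Real.rpow_add (by norm_num),
      two_rpow_two_mul_natCast_add_one, hs2, Real.rpow_intCast]
    norm_num
    ring
  have h3 : (2 : ℝ) ^ (-(α / 2 * k - 2 * ((l' : ℝ) + 1))) = 4 * s ^ 4 * x := by
    rw [show -(α / 2 * k - 2 * ((l' : ℝ) + 1)) = 2 * ((l' : ℝ) + 1) + -(α / 2 * k) by ring,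
      Real.rpow_add (by norm_num), two_rpow_two_mul_natCast_add_one, hs2]
    ring
  have h4 : 0 ≤ (2 : ℝ) ^ (-(α / 2 * k - 2 * ((l' : ℝ) + 2 + θ * Real.log k) - Real.log (γ + 1))) := by
    positivity
  rw [errorBound, h1, h2, h3, hs2]
  have hs3 : 0 < s ^ 3 := by positivity
  have e1 : 4 * (s ^ 3 * (R * x)) ≤ 4 * (s ^ 3 * (s * x)) := by gcongr
  have e2 : 4 * (s ^ 3 * ε) ≤ s ^ 3 * (s / 8) * e := by
    have : s ^ 3 * ε ≤ s ^ 3 * e := by gcongr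
    have h5 : s ^ 3 * e * 32 ≤ s ^ 3 * e * s := by gcongr
    nlinarith
  have e3 : 4 * (s ^ 3 * d) ≤ 4 * (s ^ 3 * d * s) := by
    have h5 : s ^ 3 * d * 1 ≤ s ^ 3 * d * s := by gcongr; linarith
    linarith
  calc 4 * (s ^ 2 * s) * (R * x + ε + d)
      = 4 * (s ^ 3 * d) + 4 * (s ^ 3 * ε) + 4 * (s ^ 3 * (R * x)) := by ring
    _ ≤ 4 * (s ^ 3 * d * s) + s ^ 3 * (s / 8) * e + 4 * (s ^ 3 * (s * x)) := by gcongr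
    _ = 4 * s ^ 4 * d + s ^ 4 * e / 8 + 4 * s ^ 4 * x := by ring
    _ ≤ _ := le_add_of_nonneg_right h4

theorem errorBound_le {θ δ₀ α ε₀ γ κ c : ℝ} {k l' : ℕ} (hk : 1 ≤ k) (hθ : 0 ≤ θ)
    (hl' : (l' : ℝ) ≤ κ * k) (h1 : c ≤ δ₀ - 2 * κ) (h2 : c ≤ ε₀ - 2 * κ) (h3 : c ≤ α / 2 - 2 * κ) :
    errorBound θ δ₀ α ε₀ γ k l'
      ≤ (9 + 16 * (2 : ℝ) ^ Real.log (γ + 1)) * (k : ℝ) ^ (2 * θ) * (2 : ℝ) ^ (-(c * k)) := by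
  have hk1 : (1 : ℝ) ≤ k := by exact_mod_cast hk
  have hK : 1 ≤ (k : ℝ) ^ (2 * θ) := Real.one_le_rpow hk1 (by positivity)
  set y := (2 : ℝ) ^ (-(c * k)) with hy
  set g := (2 : ℝ) ^ Real.log (γ + 1) with hg
  have hy0 : 0 < y := by positivity
  have hg0 : 0 < g := by positivity
  have hmono : ∀ a : ℝ, c ≤ a → c * k ≤ a * k := fun a ha => by gcongr
  have b1 : (2 : ℝ) ^ (-(δ₀ * k - 2 * ((l' : ℝ) + 1))) ≤ 4 * y := by
    rw [show (4 : ℝ) * y = 2 ^ ((2 : ℝ) + -(c * k)) by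
      rw [Real.rpow_add (by norm_num), ← hy]; norm_num]
    exact Real.rpow_le_rpow_of_exponent_le (by norm_num) (by linarith [hmono _ h1])
  have b2 : (2 : ℝ) ^ (-(ε₀ * k - 2 * (l' : ℝ) + 3)) ≤ y :=
    Real.rpow_le_rpow_of_exponent_le (by norm_num) (by linarith [hmono _ h2])
  have b3 : (2 : ℝ) ^ (-(α / 2 * k - 2 * ((l' : ℝ) + 1))) ≤ 4 * y := by
    rw [show (4 : ℝ) * y = 2 ^ ((2 : ℝ) + -(c * k)) by
      rw [Real.rpow_add (by norm_num), ← hy]; norm_num]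
    exact Real.rpow_le_rpow_of_exponent_le (by norm_num) (by linarith [hmono _ h3])
  have hlog : (2 : ℝ) ^ (2 * (θ * Real.log k)) ≤ (k : ℝ) ^ (2 * θ) := by
    rw [Real.rpow_def_of_pos (by norm_num), Real.rpow_def_of_pos (by linarith)]
    refine Real.exp_le_exp.2 ?_
    have hl2 : Real.log 2 ≤ 1 := by linarith [Real.log_two_lt_d9]
    have h0 : 0 ≤ 2 * (θ * Real.log k) :=
      mul_nonneg zero_le_two (mul_nonneg hθ (Real.log_nonneg hk1))
    calc Real.log 2 * (2 * (θ * Real.log k)) ≤ 1 * (2 * (θ * Real.log k)) := by gcongr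
      _ = _ := by ring
  have b4 : (2 : ℝ) ^ (-(α / 2 * k - 2 * ((l' : ℝ) + 2 + θ * Real.log k) - Real.log (γ + 1)))
      ≤ 16 * (k : ℝ) ^ (2 * θ) * g * y := by
    calc (2 : ℝ) ^ (-(α / 2 * k - 2 * ((l' : ℝ) + 2 + θ * Real.log k) - Real.log (γ + 1)))
        ≤ 2 ^ ((4 : ℝ) + 2 * (θ * Real.log k) + Real.log (γ + 1) + -(c * k)) :=
          Real.rpow_le_rpow_of_exponent_le (by norm_num) (by linarith [hmono _ h3])
      _ = 16 * 2 ^ (2 * (θ * Real.log k)) * g * y := by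
          rw [Real.rpow_add (by norm_num), Real.rpow_add (by norm_num), Real.rpow_add (by norm_num)]
          norm_num [hg, hy]
      _ ≤ _ := by gcongr
  have b5 : y ≤ (k : ℝ) ^ (2 * θ) * y := le_mul_of_one_le_left hy0.le hK
  rw [errorBound]
  linarith

/-- The discretization error is smaller than `2 ^ (-a m)` when the net has mesh
`2 ^ (-(6 + a) m)`. -/
theorem net_error_le (a m : ℕ) (hm : 1 ≤ m) :
    (2 : ℝ) ^ m * (2 * (4 ^ m * (m * (2 / ((2 ^ ((6 + a) * m) : ℕ) : ℝ))))) ≤ (1 / 2) ^ (a * m) := by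
  have hm2 : (m : ℝ) ≤ 2 ^ m := by exact_mod_cast Nat.lt_two_pow_self.le
  have h4 : (4 : ℝ) ≤ 4 ^ m := le_self_pow₀ (by norm_num) (by omega)
  have hpow : ((2 ^ ((6 + a) * m) : ℕ) : ℝ) = 2 ^ m * 4 ^ m * 2 ^ m * 4 ^ m * 2 ^ (a * m) := by
    push_cast
    rw [show (4 : ℝ) = 2 ^ 2 by norm_num, ← pow_mul, ← pow_add, ← pow_add, ← pow_add, ← pow_add]
    congr 1
    ring
  rw [hpow, one_div, inv_pow, ← one_div]
  calc (2 : ℝ) ^ m * (2 * (4 ^ m * (m * (2 / (2 ^ m * 4 ^ m * 2 ^ m * 4 ^ m * 2 ^ (a * m))))))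
      = (m * 4) / (2 ^ m * 4 ^ m) * (1 / 2 ^ (a * m)) := by field_simp; ring
    _ ≤ 1 * (1 / 2 ^ (a * m)) := by
        gcongr
        rw [div_le_one (by positivity)]
        gcongr
    _ = _ := one_mul _

/-- The size of the net and the number of pairs of characters, against the failure probability
for one of them. -/
theorem union_bound_le {a m l' p : ℕ} {R : ℝ} (hm : 1 ≤ m) (hl' : 2 * l' ≤ a * m)
    (hmR : (m : ℝ) ^ 2 ≤ R) (hp : (64 + 9 * a + 1) * R ≤ (2 * p : ℕ)) :
    ((2 * 2 ^ ((6 + a) * m) + 1 : ℕ) : ℝ) ^ (8 * m) * (2 ^ l') ^ 2 * (1 / 2) ^ (2 * p)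
      ≤ Real.exp (-(Real.log 2 * R)) := by
  have hN : ((2 * 2 ^ ((6 + a) * m) + 1 : ℕ) : ℝ) ≤ 2 ^ ((8 + a) * m) := by
    have h1 : 2 * 2 ^ ((6 + a) * m) + 1 ≤ 2 ^ ((6 + a) * m) * 2 ^ (2 * m) := by
      have h2 : 2 ^ 2 ≤ 2 ^ (2 * m) := Nat.pow_le_pow_right (by norm_num) (by omega)
      have h3 : 1 ≤ 2 ^ ((6 + a) * m) := Nat.one_le_two_pow
      nlinarith
    rw [← pow_add, ← add_mul] at h1
    rw [show 8 + a = 6 + a + 2 by ring]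
    exact_mod_cast h1
  have hexp : (8 + a) * m * (8 * m) + 2 * l' ≤ (64 + 9 * a) * m ^ 2 := by nlinarith
  have hcast : (((8 + a) * m * (8 * m) + 2 * l' : ℕ) : ℝ) ≤ (64 + 9 * a) * R := by
    have : (((8 + a) * m * (8 * m) + 2 * l' : ℕ) : ℝ) ≤ (64 + 9 * a) * (m : ℝ) ^ 2 := by
      exact_mod_cast hexp
    refine this.trans ?_
    gcongr
  calc ((2 * 2 ^ ((6 + a) * m) + 1 : ℕ) : ℝ) ^ (8 * m) * (2 ^ l') ^ 2 * (1 / 2) ^ (2 * p)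
      ≤ (2 ^ ((8 + a) * m)) ^ (8 * m) * (2 ^ l') ^ 2 * (1 / 2) ^ (2 * p) := by gcongr
    _ = (2 : ℝ) ^ ((((8 + a) * m * (8 * m) + 2 * l' : ℕ) : ℝ) - (2 * p : ℕ)) := by
        rw [Real.rpow_sub (by norm_num), Real.rpow_natCast, Real.rpow_natCast, ← pow_mul, ← pow_mul,
          mul_comm l' 2, ← pow_add, one_div, inv_pow, div_eq_mul_inv]
    _ ≤ (2 : ℝ) ^ (-R) := Real.rpow_le_rpow_of_exponent_le (by norm_num) (by linarith)
    _ = _ := by rw [Real.rpow_def_of_pos (by norm_num), mul_neg]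

end IsolatedQubits

end

theorem theorem3p1 (θ δ₀ α : ℝ) (hθ : 1 ≤ θ) (hδ₀ : 0 < δ₀) (hα : 0 < α) :
    ∃ γ : ℝ, 0 < γ ∧
    ∀ ε₀ κ : ℝ, 0 < ε₀ → 0 < κ → κ < min (δ₀ / 2) (min (ε₀ / 2) (α / 4)) →
    ∃ (k₀ : ℕ) (c₁ c₂ : ℝ), 1 ≤ k₀ ∧ 0 < c₁ ∧ 0 < c₂ ∧
    ∀ (k : ℕ), k₀ ≤ k →
    ∀ (l m : ℕ), k ≤ l → k ≤ m → (m : ℝ) ≤ (k : ℝ) ^ θ →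
    ∀ (P : IsolatedQubits.ROTProtocol m l) (η ε : ℝ),
      P.Correct η →
      0 ≤ ε → ε ≤ (2 : ℝ) ^ (-(ε₀ * k)) →
      P.LeakySecure ((2 : ℝ) ^ (-(δ₀ * k))) ε (α * k) →
    ∀ (r l' : ℕ), r = ⌈4 * (γ + 1) * (k : ℝ) ^ (2 * θ)⌉₊ → l' = ⌊κ * k⌋₊ →
    ∀ (I J : Type) [Fintype I] [Fintype J]
      (F : I → IsolatedQubits.Bits l → IsolatedQubits.Bits l')
      (G : J → IsolatedQubits.Bits l → IsolatedQubits.Bits l'),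
      IsolatedQubits.WiseIndependent r F → IsolatedQubits.WiseIndependent r G →
      IsolatedQubits.unifProb {f : I × J |
          ¬ ((P.hash (F f.1) (G f.2)).Correct η ∧
             (P.hash (F f.1) (G f.2)).SecureForAlice
               (IsolatedQubits.errorBound θ δ₀ α ε₀ γ k l'))}
        ≤ Real.exp (-(c₁ * (k : ℝ) ^ (2 * θ))) ∧
      IsolatedQubits.errorBound θ δ₀ α ε₀ γ k l' ≤ (2 : ℝ) ^ (-(c₂ * k)) := by
  set a : ℕ := ⌈α⌉₊ with ha
  have hαa : α ≤ a := Nat.le_ceil α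
  -- The net has at most `2 ^ (8 (8 + a) m ^ 2)` elements, and there are at most `2 ^ (a m)` pairs of
  -- characters.
  set γ : ℝ := 64 + 9 * a with hγ
  have hγ0 : 0 < γ := by positivity
  refine ⟨γ, hγ0, fun ε₀ κ hε₀ hκ hκlt => ?_⟩
  obtain ⟨hκ1, hκ'⟩ := lt_min_iff.1 hκlt
  obtain ⟨hκ2, hκ3⟩ := lt_min_iff.1 hκ'
  set c : ℝ := min (δ₀ - 2 * κ) (min (ε₀ - 2 * κ) (α / 2 - 2 * κ)) with hc
  have hc0 : 0 < c := lt_min (by linarith) (lt_min (by linarith) (by linarith))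
  -- The first condition makes `2 ^ (l' / 2)` exceed the polynomial losses, and the second lets the
  -- exponential decay of the error bound absorb its polynomial factor.
  set C₁ : ℝ := 2 * (8 * (4 * (γ + 1) + 1) ^ 2 + 32) with hC₁
  set C₂ : ℝ := 9 + 16 * (2 : ℝ) ^ Real.log (γ + 1) with hC₂
  obtain ⟨k₁, hk₁⟩ := Filter.eventually_atTop.1
    ((IsolatedQubits.eventually_mul_rpow_le C₁ (4 * θ) (half_pos hκ)).and
      (IsolatedQubits.eventually_mul_rpow_le C₂ (2 * θ) (half_pos hc0)))
  refine ⟨max 1 k₁, Real.log 2, c / 2, le_max_left _ _, Real.log_pos (by norm_num), half_pos hc0, ?_⟩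
  intro k hk l m _ hkm hmk P η ε hcorr hε0 hε hleak r l' hr hl' I J _ _ F G hF hG
  obtain ⟨hpoly₁, hpoly₂⟩ := hk₁ k ((le_max_right _ _).trans hk)
  have hk1 : 1 ≤ k := (le_max_left _ _).trans hk
  have hk1' : (1 : ℝ) ≤ k := by exact_mod_cast hk1
  have hm1 : 1 ≤ m := hk1.trans hkm
  set R : ℝ := (k : ℝ) ^ (2 * θ) with hR
  have hR1 : 1 ≤ R := Real.one_le_rpow hk1' (by linarith)
  have hl'le : (l' : ℝ) ≤ κ * k := hl' ▸ Nat.floor_le (by positivity)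
  have hl'ge : κ * k < l' + 1 := hl' ▸ Nat.lt_floor_add_one _
  constructor
  · have hrge : 4 * (γ + 1) * R ≤ r := hr ▸ Nat.le_ceil _
    have hrlt : (r : ℝ) < 4 * (γ + 1) * R + 1 := hr ▸ Nat.ceil_lt_add_one (by positivity)
    set p : ℕ := r / 2 with hp
    have h2p : 2 * p ≤ r := by omega
    have h2p' : (r : ℝ) ≤ (2 * p : ℕ) + 1 := by exact_mod_cast (by omega : r ≤ 2 * p + 1)
    have hγR : γ + 1 ≤ (γ + 1) * R := le_mul_of_one_le_right (by positivity) hR1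
    have hγ64 : 64 ≤ γ := by rw [hγ]; linarith [Nat.cast_nonneg (α := ℝ) a]
    have hpR : (γ + 1) * R ≤ (2 * p : ℕ) := by linarith
    have hp2 : 2 ≤ p := by
      have : (4 : ℝ) ≤ (2 * p : ℕ) := by linarith
      have : 4 ≤ 2 * p := by exact_mod_cast this
      omega
    set x : ℝ := (2 : ℝ) ^ (-(α / 2 * k)) with hx
    have hx0 : 0 < x := by positivity
    have hx2 : x ^ 2 = (2 : ℝ) ^ (-(α * k)) := by
      rw [hx, ← Real.rpow_natCast, ← Real.rpow_mul (by norm_num)]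
      congr 1
      push_cast
      ring
    have hδ : 0 < (2 : ℝ) ^ (-(δ₀ * k)) := by positivity
    have hmain := P.unifProb_not_secure_le hδ hε0 hx0 (fun K hK hneg => by
      have hne : IsolatedQubits.effectOf K ≠ 0 := fun h0 => by
        have := hK.trace_effectOf
        rw [h0, Matrix.trace_zero] at this
        exact zero_ne_one this
      rw [hx2]
      exact IsolatedQubits.exists_of_le_smoothMinEntropy
        (hleak _ hK.isSeparableOutcome hne hneg)) hp2 h2p hF hG
        (N := 2 ^ ((6 + a) * m)) (by positivity)
    refine (IsolatedQubits.unifProb_mono ?_).trans (hmain.trans ?_)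
    · intro f hf hsec
      refine hf ⟨hcorr.hash _ _, hsec.mono ?_⟩
      have hnet : (2 : ℝ) ^ m * (2 * (4 ^ m * (m * (2 / ((2 ^ ((6 + a) * m) : ℕ) : ℝ))))) ≤ x := by
        refine (IsolatedQubits.net_error_le a m hm1).trans ?_
        rw [one_div, inv_pow, ← Real.rpow_natCast, ← Real.rpow_neg (by norm_num), hx]
        refine Real.rpow_le_rpow_of_exponent_le (by norm_num) (neg_le_neg ?_)
        push_cast
        have hkm' : (k : ℝ) ≤ m := by exact_mod_cast hkm
        gcongr
        linarith
      have hsqrt : 8 * (2 * p : ℕ) ^ 2 + 32 ≤ Real.sqrt (2 ^ l') := by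
        have h1 : ((2 * p : ℕ) : ℝ) ≤ (4 * (γ + 1) + 1) * R := by
          have : ((2 * p : ℕ) : ℝ) ≤ r := by exact_mod_cast h2p
          linarith
        have hRR : R ^ 2 = (k : ℝ) ^ (4 * θ) := by
          rw [hR, ← Real.rpow_natCast, ← Real.rpow_mul (by positivity)]
          congr 1
          push_cast
          ring
        have h2 : 8 * ((2 * p : ℕ) : ℝ) ^ 2 + 32 ≤ (2 : ℝ) ^ (κ / 2 * k) / 2 := by
          calc 8 * ((2 * p : ℕ) : ℝ) ^ 2 + 32 ≤ 8 * ((4 * (γ + 1) + 1) * R) ^ 2 + 32 * R ^ 2 := by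
                gcongr
                linarith [one_le_pow₀ hR1 (n := 2)]
            _ = C₁ * (k : ℝ) ^ (4 * θ) / 2 := by rw [← hRR, hC₁]; ring
            _ ≤ _ := by gcongr
        refine h2.trans (Real.le_sqrt_of_sq_le ?_)
        rw [div_pow, ← Real.rpow_natCast, ← Real.rpow_mul (by norm_num), ← Real.rpow_natCast 2 l',
          div_le_iff₀ (by norm_num)]
        calc (2 : ℝ) ^ (κ / 2 * k * (2 : ℕ)) ≤ 2 ^ ((l' : ℝ) + 2) :=
              Real.rpow_le_rpow_of_exponent_le (by norm_num) (by push_cast; linarith)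
          _ = _ := by rw [Real.rpow_add (by norm_num)]; norm_num
      refine le_trans ?_ (IsolatedQubits.error_le_errorBound (R := 8 * (2 * p : ℕ) ^ 2 + 1) hε ?_ ?_)
      · rw [← hx]
        refine mul_le_mul_of_nonneg_left ?_ (by positivity)
        linarith
      · exact le_trans (le_add_of_nonneg_left (by positivity)) hsqrt
      · linarith
    · refine IsolatedQubits.union_bound_le hm1 ?_ ?_ hpR
      · have hkm' : (k : ℝ) ≤ m := by exact_mod_cast hkm
        have h1 : (2 : ℝ) * l' ≤ a * m := by
          calc (2 : ℝ) * l' ≤ 2 * κ * k := by linarith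
            _ ≤ a * m := by gcongr; linarith
        exact_mod_cast h1
      · calc (m : ℝ) ^ 2 ≤ ((k : ℝ) ^ θ) ^ 2 := by gcongr
          _ = R := by
            rw [hR, ← Real.rpow_natCast, ← Real.rpow_mul (by positivity)]
            congr 1
            push_cast
            ring
  · refine (IsolatedQubits.errorBound_le hk1 (by linarith) hl'le (min_le_left _ _)
      ((min_le_right _ _).trans (min_le_left _ _))
      ((min_le_right _ _).trans (min_le_right _ _))).trans ?_
    calc C₂ * R * (2 : ℝ) ^ (-(c * k)) ≤ (2 : ℝ) ^ (c / 2 * k) * (2 : ℝ) ^ (-(c * k)) := by gcongr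
      _ = (2 : ℝ) ^ (-(c / 2 * k)) := by
        rw [← Real.rpow_add (by norm_num)]
        congr 1
        ring
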